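/- **Theorem (Classification of simple non-generic domains in $\mathbb{H}^n$).** Let $n\ge 2$ and let $\mathbb{H}^n=\{y\in\mathbb{R}^n: y_n>0\}$ be the upper half-space model of hyperbolic space, with metric $g=y_n^{-2}\delta$ ($\delta$ the Euclidean metric). A *simple non-generic domain* in $\mathbb{H}^n$ is a connected open set $\Omega\subset\mathbb{H}^n$ such that * the boundary $\Sigma=\partial\Omega$ of $\Omega$ in $\mathbb{H}^n$ is non-empty, connected and smooth, with $\Omega$ locally on one side of it (so that $\overline\Omega=\Omega\cup\Sigma$ is a complete smooth manifold with boundary $\Sigma$), and * there is a function $u\in C^\infty(\overline\Omega)$, not identically zero, with $$-(\Delta u)\,g+\operatorname{Hess}u-u\operatorname{Ric}=0\ \text{ in }\Omega,\qquad u_\nu\,\hat g=u\,h\ \text{ on }\Sigma,$$ where $\hat g$ is the metric induced on $\Sigma$, $\nu$ is the outward unit normal, and $h(X,Y)=-\langle\nu,D_XY\rangle$ is the second fundamental form. Then a set $\Sigma\subset\mathbb{H}^n$ is the boundary in $\mathbb{H}^n$ of some simple non-generic domain if and only if it is of one of the following four types: 1. a horosphere: $\Sigma=S\cap\mathbb{H}^n$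 for a Euclidean sphere $S$ of radius $r>0$ whose centre has height $y_n=r$ (so $S$ is tangent to $\{y_n=0\}$); 2. a hypersphere: $\Sigma=S\cap\mathbb{H}^n$ for a Euclidean sphere $S$ of radius $r>0$ whose centre has height in $(-r,r)$ (so $S$ crosses $\{y_n=0\}$ at an angle in $(0,\pi)$); 3. a geodesic sphere: $\Sigma=S$ for a Euclidean sphere $S$ of positive radius contained in $\mathbb{H}^n$; 4. a non-empty intersection $\Sigma=P\cap\mathbb{H}^n$ with a Euclidean hyperplane $P\subset\mathbb{R}^n$. -/

import Mathlib

open scoped ContDiff Topology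

noncomputable section

namespace Coord

/-! Riemannian geometry of an open set `M` of `ℝ^ι` in its standard coordinates.  A metric is given
by its component functions `x ↦ g_{ij}(x)`; all derivatives below are taken at points of `M`. -/

/-- The partial derivative `∂ᵢ f (x)`. -/
def partialDeriv {ι : Type} [Fintype ι] [DecidableEq ι] (i : ι)
    (f : EuclideanSpace ℝ ι → ℝ) (x : EuclideanSpace ℝ ι) : ℝ :=
  fderiv ℝ f x (EuclideanSpace.single i 1)

/-- The inner product `⟨X, Y⟩ = g_{ij} Xⁱ Yʲ` of two tangent vectors at `x`. -/
def metricInner {ι : Type} [Fintype ι] (g : EuclideanSpace ℝ ι → Matrix ι ι ℝ)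
    (x X Y : EuclideanSpace ℝ ι) : ℝ :=
  ∑ i, ∑ j, g x i j * X i * Y j

/-- The Christoffel symbol `Γᵏᵢⱼ = ½ gᵏˡ (∂ᵢ g_{lj} + ∂ⱼ g_{li} - ∂ₗ g_{ij})` of the Levi-Civita
connection. -/
def christoffel {ι : Type} [Fintype ι] [DecidableEq ι] (g : EuclideanSpace ℝ ι → Matrix ι ι ℝ)
    (k i j : ι) (x : EuclideanSpace ℝ ι) : ℝ :=
  (1 / 2 : ℝ) * ∑ l, (g x)⁻¹ k l *
    (partialDeriv i (fun y => g y l j) x + partialDeriv j (fun y => g y l i) x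
      - partialDeriv l (fun y => g y i j) x)

/-- The Ricci tensor
`Ric_{ij} = ∂ₖ Γᵏᵢⱼ - ∂ⱼ Γᵏᵢₖ + Γᵏₖₗ Γˡᵢⱼ - Γᵏⱼₗ Γˡᵢₖ` (positive on round spheres). -/
def ricci {ι : Type} [Fintype ι] [DecidableEq ι] (g : EuclideanSpace ℝ ι → Matrix ι ι ℝ)
    (i j : ι) (x : EuclideanSpace ℝ ι) : ℝ :=
  ∑ k, (partialDeriv k (christoffel g k i j) x - partialDeriv j (christoffel g k i k) x)
    + ∑ k, ∑ l, (christoffel g k k l x * christoffel g l i j x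
      - christoffel g k j l x * christoffel g l i k x)

/-- The Hessian `(Hess u)_{ij} = ∂ᵢ ∂ⱼ u - Γᵏᵢⱼ ∂ₖ u`. -/
def hessian {ι : Type} [Fintype ι] [DecidableEq ι] (g : EuclideanSpace ℝ ι → Matrix ι ι ℝ)
    (u : EuclideanSpace ℝ ι → ℝ) (i j : ι) (x : EuclideanSpace ℝ ι) : ℝ :=
  partialDeriv i (partialDeriv j u) x - ∑ k, christoffel g k i j x * partialDeriv k u x

/-- The Laplacian `Δ u = gⁱʲ (Hess u)_{ij}`. -/
def laplacian {ι : Type} [Fintype ι] [DecidableEq ι] (g : EuclideanSpace ℝ ι → Matrix ι ι ℝ)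
    (u : EuclideanSpace ℝ ι → ℝ) (x : EuclideanSpace ℝ ι) : ℝ :=
  ∑ i, ∑ j, (g x)⁻¹ i j * hessian g u i j x

/-- The gradient vector field `(grad ρ)ⁱ = gⁱʲ ∂ⱼ ρ`. -/
def gradient {ι : Type} [Fintype ι] [DecidableEq ι] (g : EuclideanSpace ℝ ι → Matrix ι ι ℝ)
    (ρ : EuclideanSpace ℝ ι → ℝ) (x : EuclideanSpace ℝ ι) : EuclideanSpace ℝ ι :=
  WithLp.toLp 2 fun i => ∑ j, (g x)⁻¹ i j * partialDeriv j ρ x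

/-- The vector field `grad ρ / |grad ρ|`: at a point of a boundary that is given locally
by `ρ = 0`, with the domain on the side `ρ < 0`, it is the outward unit normal. -/
def unitNormal {ι : Type} [Fintype ι] [DecidableEq ι] (g : EuclideanSpace ℝ ι → Matrix ι ι ℝ)
    (ρ : EuclideanSpace ℝ ι → ℝ) (x : EuclideanSpace ℝ ι) : EuclideanSpace ℝ ι :=
  (Real.sqrt (metricInner g x (gradient g ρ x) (gradient g ρ x)))⁻¹ • gradient g ρ x

/-- The covariant derivative `(D_X V)ᵏ = Xⁱ ∂ᵢ Vᵏ + Γᵏᵢⱼ Xⁱ Vʲ` of a vector field `V` at `x` in the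
direction of the tangent vector `X`. -/
def covDeriv {ι : Type} [Fintype ι] [DecidableEq ι] (g : EuclideanSpace ℝ ι → Matrix ι ι ℝ)
    (V : EuclideanSpace ℝ ι → EuclideanSpace ℝ ι) (x X : EuclideanSpace ℝ ι) :
    EuclideanSpace ℝ ι :=
  WithLp.toLp 2 fun k =>
    fderiv ℝ V x X k + ∑ i, ∑ j, christoffel g k i j x * X i * V x j

/-- The second fundamental form of `{ρ = 0}` with respect to the normal `ν = grad ρ / |grad ρ|`:
`h(X, Y) = ⟨D_X ν, Y⟩` for `X, Y` tangent to `{ρ = 0}` at `x`.  As `⟨ν, Y⟩ = 0` for every vector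
field `Y` tangent to `{ρ = 0}`, this is the same as `h(X, Y) = -⟨ν, D_X Y⟩`. -/
def secondFundamentalForm {ι : Type} [Fintype ι] [DecidableEq ι]
    (g : EuclideanSpace ℝ ι → Matrix ι ι ℝ) (ρ : EuclideanSpace ℝ ι → ℝ)
    (x X Y : EuclideanSpace ℝ ι) : ℝ :=
  metricInner g x (covDeriv g (unitNormal g ρ) x X) Y

/-- `ρ` is a smooth defining function of `Ω` near `p`: on an open neighbourhood `U` of `p` it is
smooth, has no critical point, and `Ω` is the set where `ρ < 0` (so `∂Ω = {ρ = 0}` in `U`, and the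
tangent space of `∂Ω` at `p` is the kernel of `dρ` at `p`). -/
def IsLocalDefiningFunction {ι : Type} [Fintype ι] (Ω : Set (EuclideanSpace ℝ ι))
    (p : EuclideanSpace ℝ ι) (ρ : EuclideanSpace ℝ ι → ℝ) : Prop :=
  ∃ U : Set (EuclideanSpace ℝ ι), IsOpen U ∧ p ∈ U ∧ ContDiffOn ℝ ∞ ρ U ∧
    (∀ x ∈ U, fderiv ℝ ρ x ≠ 0) ∧ Ω ∩ U = {x ∈ U | ρ x < 0}

/-- The boundary `Σ = ∂Ω` of `Ω` relative to the open set `M`. -/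
def boundaryIn {ι : Type} [Fintype ι] (M Ω : Set (EuclideanSpace ℝ ι)) :
    Set (EuclideanSpace ℝ ι) :=
  frontier Ω ∩ M

/-- The closure `Ω ∪ ∂Ω` of `Ω` relative to the open set `M`. -/
def closureIn {ι : Type} [Fintype ι] (M Ω : Set (EuclideanSpace ℝ ι)) :
    Set (EuclideanSpace ℝ ι) :=
  closure Ω ∩ M

/-- `Ω` is a connected smooth domain in `M`: open, connected, and `Ω ∪ ∂Ω` (boundary and closure
relative to `M`) is a smooth manifold with boundary `∂Ω`.  If `M` is complete, then so
is `Ω ∪ ∂Ω`, as a closed subset of `M`. -/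
structure IsSmoothDomain {ι : Type} [Fintype ι] (M Ω : Set (EuclideanSpace ℝ ι)) : Prop where
  subset : Ω ⊆ M
  isOpen : IsOpen Ω
  isConnected : IsConnected Ω
  smooth_boundary : ∀ p ∈ boundaryIn M Ω, ∃ ρ, IsLocalDefiningFunction Ω p ρ

/-- `u` is a static potential on `(Ω, ∂Ω)`: it is smooth up to the boundary, not identically zero,
solves `-(Δu) g + Hess u - u Ric = 0` in `Ω`, and satisfies `u_ν ĝ = u h` on `∂Ω`, as bilinear
forms on the tangent spaces of `∂Ω`.  The normal `ν` and the form `h` at a point of `∂Ω` are computed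
from a local defining function and do not depend on its choice; the derivative of `u` at a boundary
point is the derivative within `Ω ∪ ∂Ω`. -/
structure IsStaticPotential {ι : Type} [Fintype ι] [DecidableEq ι]
    (M : Set (EuclideanSpace ℝ ι)) (g : EuclideanSpace ℝ ι → Matrix ι ι ℝ)
    (Ω : Set (EuclideanSpace ℝ ι)) (u : EuclideanSpace ℝ ι → ℝ) : Prop where
  smooth : ContDiffOn ℝ ∞ u (closureIn M Ω)
  nontrivial : ∃ x ∈ Ω, u x ≠ 0
  interior_eq : ∀ x ∈ Ω, ∀ i j,
    -(laplacian g u x) * g x i j + hessian g u i j x - u x * ricci g i j x = 0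
  boundary_eq : ∀ p ∈ boundaryIn M Ω, ∃ ρ, IsLocalDefiningFunction Ω p ρ ∧
    ∀ X Y : EuclideanSpace ℝ ι, fderiv ℝ ρ p X = 0 → fderiv ℝ ρ p Y = 0 →
      fderivWithin ℝ u (closureIn M Ω) p (unitNormal g ρ p) * metricInner g p X Y
        = u p * secondFundamentalForm g ρ p X Y

/-- `Ω` is a simple non-generic domain of `(M, g)`: a connected smooth domain that admits a static
potential and whose boundary has exactly one connected component. -/
structure IsSimpleNonGenericDomain {ι : Type} [Fintype ι] [DecidableEq ι]
    (M : Set (EuclideanSpace ℝ ι)) (g : EuclideanSpace ℝ ι → Matrix ι ι ℝ)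
    (Ω : Set (EuclideanSpace ℝ ι)) : Prop where
  isSmoothDomain : IsSmoothDomain M Ω
  isConnected_boundary : IsConnected (boundaryIn M Ω)
  exists_potential : ∃ u, IsStaticPotential M g Ω u

end Coord

namespace HalfSpace

/-- The upper half-space model of hyperbolic space of dimension `m + 1`; the height of a point is its
last coordinate. -/
def hyperbolicSpace (m : ℕ) : Set (EuclideanSpace ℝ (Fin (m + 1))) :=
  {y | 0 < y (Fin.last m)}

/-- The hyperbolic metric: the Euclidean metric divided by the square of the height. -/
def hyperbolicMetric (m : ℕ) (y : EuclideanSpace ℝ (Fin (m + 1))) :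
    Matrix (Fin (m + 1)) (Fin (m + 1)) ℝ :=
  ((y (Fin.last m)) ^ 2)⁻¹ • (1 : Matrix (Fin (m + 1)) (Fin (m + 1)) ℝ)

/-- A horosphere: the part in the half-space of a Euclidean sphere that is tangent from above to the
boundary hyperplane (the height of its centre equals its radius). -/
def IsHorosphere (m : ℕ) (S : Set (EuclideanSpace ℝ (Fin (m + 1)))) : Prop :=
  ∃ (c : EuclideanSpace ℝ (Fin (m + 1))) (r : ℝ), 0 < r ∧ c (Fin.last m) = r ∧
    S = Metric.sphere c r ∩ hyperbolicSpace m

/-- A hypersphere: the part in the half-space of a Euclidean sphere that crosses the boundary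
hyperplane at an angle in `(0, π)` (the height of its centre lies strictly between `-r` and `r`;
height `0` gives the totally geodesic hemispheres). -/
def IsHypersphere (m : ℕ) (S : Set (EuclideanSpace ℝ (Fin (m + 1)))) : Prop :=
  ∃ (c : EuclideanSpace ℝ (Fin (m + 1))) (r : ℝ), 0 < r ∧ |c (Fin.last m)| < r ∧
    S = Metric.sphere c r ∩ hyperbolicSpace m

/-- A geodesic sphere: in the half-space model these are the Euclidean spheres that are contained in
the half-space. -/
def IsGeodesicSphere (m : ℕ) (S : Set (EuclideanSpace ℝ (Fin (m + 1)))) : Prop :=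
  ∃ (c : EuclideanSpace ℝ (Fin (m + 1))) (r : ℝ), 0 < r ∧
    Metric.sphere c r ⊆ hyperbolicSpace m ∧ S = Metric.sphere c r

/-- A non-empty intersection of the half-space with a Euclidean hyperplane `⟨a, y⟩ = b`. -/
def IsHyperplaneSection (m : ℕ) (S : Set (EuclideanSpace ℝ (Fin (m + 1)))) : Prop :=
  ∃ (a : EuclideanSpace ℝ (Fin (m + 1))) (b : ℝ), a ≠ 0 ∧
    S = {y | inner ℝ a y = b} ∩ hyperbolicSpace m ∧ S.Nonempty

end HalfSpace

end

/-!
Write a function on the half-space as `u = W / yₙ`. As hyperbolic space is Einstein, the static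
equation is `Hess u = u g` (`HalfSpace.static_equation_iff`), and in Euclidean terms this says that
`∂ᵢ∂ⱼ W = δᵢⱼ ∂ₙ W / yₙ`; its solutions on a connected open set are
`W = A |y|² + ⟨B, y⟩ + C` with `Bₙ = 0` (`HalfSpace.exists_quadratic_of_hessian`). The boundary
condition `u_ν ĝ = u h` is conformally invariant: it is the Euclidean Robin condition
`⟨V, N⟩ = W dN` on the tangent spaces of the boundary, with `N` the Euclidean unit normal and
`V = 2 A y + B` the gradient of `W` (`HalfSpace.boundary_condition_iff`).

*The boundary is a sphere or a hyperplane.* As `dV` is a multiple of the identity, differentiation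
of `⟨V, N⟩` along the boundary gives `W d⟨V, N⟩ = ⟨V, W dN⟩ = ⟨V, N⟩ dW`, so that the principal
curvature `k = ⟨V, N⟩ / W` is locally constant where `W ≠ 0`, and then so is `N - k y`. This argument
includes curves in the hyperbolic plane, where umbilicity alone says nothing. At a zero of `W` on
the boundary `V` is tangent and non-zero, so that the boundary and `W` can be straightened
simultaneously; the constants `k` on the two sides are both the slope of `⟨V, N⟩` against `W`, and they
agree (`IsRobinHypersurface.eventually_umbilic`). By connectedness `N = k y + c` on the whole boundary,
hence `k |y|² + 2 ⟨c, y⟩` is constant on it. The boundary is relatively closed and open in this sphere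
or hyperplane, whose part in the half-space is connected, and therefore equals it
(`HalfSpace.boundary_eq_sphere_or_hyperplane`).

*All of them occur.* The domains are `{a |y|² + ⟨v, y⟩ + d < 0}`. On the boundary the shape operator is
`2 a / |2 a y + v|`, so that `W = ⟨B, y⟩ + C` with `Bₙ = 0` satisfies the Robin condition as soon
as `2 a C = ⟨B, v⟩` (`HalfSpace.isSimpleNonGenericDomain_quadratic`). For the ball with centre `c`
the potential `(y₀ - c₀) / yₙ` serves, for a half-space `1 / yₙ`.
-/

noncomputable section

/-! ### Calculus and topology -/

theorem eq_of_hasDerivAt_zero_Icc {F : Type*} [NormedAddCommGroup F] [NormedSpace ℝ F]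
    {g : ℝ → F} (h : ∀ t ∈ Set.Icc (0 : ℝ) 1, HasDerivAt g 0 t) :
    ∀ t ∈ Set.Icc (0 : ℝ) 1, g t = g 0 :=
  constant_of_has_deriv_right_zero (fun t ht => (h t ht).continuousAt.continuousWithinAt)
    (fun t ht => (h t (Set.Ico_subset_Icc_self ht)).hasDerivWithinAt)

theorem eq_of_eventually_eq_of_isPreconnected {X α : Type*} [TopologicalSpace X] {s : Set X}
    (hs : IsPreconnected s) {f : X → α} (h : ∀ p ∈ s, ∀ᶠ q in 𝓝 p, q ∈ s → f q = f p) {x y : X}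
    (hx : x ∈ s) (hy : y ∈ s) : f x = f y := by
  have hlc : IsLocallyConstant fun p : s => f p := by
    rw [IsLocallyConstant.iff_eventually_eq]
    rintro ⟨p, hp⟩
    exact (continuousAt_subtype_val.eventually (h p hp)).mono fun q hq => hq q.2
  have : PreconnectedSpace s := Subtype.preconnectedSpace hs
  exact hlc.apply_eq_of_preconnectedSpace ⟨x, hx⟩ ⟨y, hy⟩

/-- A preconnected set `Q` is contained in a closed set `F` that meets it if `Q ∩ F` is open in `Q`. -/
theorem IsPreconnected.subset_of_isClosed_of_relatively_open {X : Type*} [TopologicalSpace X] {Q F : Set X}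
    (hQ : IsPreconnected Q) (hF : IsClosed F) (hne : (Q ∩ F).Nonempty)
    (hopen : ∀ p ∈ Q ∩ F, ∀ᶠ x in 𝓝 p, x ∈ Q → x ∈ F) : Q ⊆ F := by
  by_contra hsub
  obtain ⟨y, hyQ, hyF⟩ := Set.not_subset.1 hsub
  obtain ⟨x, hxQ, hxO, hxF⟩ := hQ {x | ∀ᶠ y in 𝓝 x, y ∈ Q → y ∈ F} Fᶜ
    isOpen_setOfPred_eventually_nhds hF.isOpen_compl
    (fun x hx => (em (x ∈ F)).imp (fun h => hopen x ⟨hx, h⟩) id)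
    (hne.imp fun x hx => ⟨hx.1, hopen x hx⟩) ⟨y, hyQ, hyF⟩
  exact hxF (hxO.self_of_nhds hxQ)

theorem eventually_neg_of_fderiv_neg {E : Type*} [NormedAddCommGroup E] [NormedSpace ℝ E]
    {ρ : E → ℝ} {p v : E} (hρ : DifferentiableAt ℝ ρ p) (hp : ρ p = 0) (hv : fderiv ℝ ρ p v < 0) :
    ∀ᶠ t : ℝ in 𝓝[>] 0, ρ (p + t • v) < 0 := by
  have hl : HasDerivAt (fun t : ℝ => p + t • v) v 0 := by
    simpa using ((hasDerivAt_id (0 : ℝ)).smul_const v).const_add p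
  have hd : HasDerivAt (fun t : ℝ => ρ (p + t • v)) (fderiv ℝ ρ p v) 0 :=
    HasFDerivAt.comp_hasDerivAt (l := ρ) (f := fun t : ℝ => p + t • v) 0
      (by simpa using hρ.hasFDerivAt) hl
  have hs := (hasDerivAt_iff_tendsto_slope.1 hd).eventually_lt_const hv
  have hs' := hs.filter_mono (nhdsWithin_mono 0 (fun t (ht : t ∈ Set.Ioi (0 : ℝ)) =>
    (ne_of_gt ht : t ≠ 0)))
  filter_upwards [hs', self_mem_nhdsWithin] with t ht htpos
  have htpos' : 0 < t := htpos
  rw [slope_def_field] at ht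
  simp only [zero_smul, add_zero, hp, sub_zero] at ht
  by_contra h
  exact absurd ht (not_lt.2 (div_nonneg (not_lt.1 h) htpos'.le))

/-- Let `ρ` and `G` increase in the direction `n` near `p`, and let `G = b` on `{ρ = 0}`
near `p`. Then, conversely, `ρ = 0` on `{G = b}` near `p`. -/
theorem eventually_level_subset_of_level_subset {E : Type*} [NormedAddCommGroup E]
    [NormedSpace ℝ E] {ρ G : E → ℝ} {p n : E} {b : ℝ} (hρ : ContDiffAt ℝ 1 ρ p)
    (hG : ContDiffAt ℝ 1 G p) (hρn : 0 < fderiv ℝ ρ p n) (hGn : 0 < fderiv ℝ G p n)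
    (hp : ρ p = 0) (h : ∀ᶠ x in 𝓝 p, ρ x = 0 → G x = b) :
    ∀ᶠ x in 𝓝 p, G x = b → ρ x = 0 := by
  have hev : ∀ f : E → ℝ, ContDiffAt ℝ 1 f p → 0 < fderiv ℝ f p n →
      ∀ᶠ x in 𝓝 p, DifferentiableAt ℝ f x ∧ 0 < fderiv ℝ f x n := by
    intro f hf hfn
    have hc : ContinuousAt (fun x => fderiv ℝ f x n) p :=
      ((hf.fderiv_right (m := 0) (by norm_num)).continuousAt).clm_apply continuousAt_const
    filter_upwards [hf.eventually (by simp), hc.eventually_const_lt hfn] with x h1 h2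
    exact ⟨h1.differentiableAt (by simp), h2⟩
  obtain ⟨r, hr, hball⟩ := Metric.eventually_nhds_iff_ball.1
    ((hev ρ hρ hρn).and ((hev G hG hGn).and h))
  have hn : n ≠ 0 := by
    rintro rfl
    simp at hρn
  have hnpos : 0 < ‖n‖ := norm_pos_iff.2 hn
  set δ := r / 2 / ‖n‖ with hδ
  have hδpos : 0 < δ := by positivity
  have hmem : ∀ x ∈ Metric.ball p (r / 2), ∀ t ∈ Set.Icc (-δ) δ, x + t • n ∈ Metric.ball p r := by
    intro x hx t ht
    rw [mem_ball_iff_norm] at hx ⊢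
    calc ‖x + t • n - p‖ = ‖(x - p) + t • n‖ := by congr 1; abel
      _ ≤ ‖x - p‖ + |t| * ‖n‖ := (norm_add_le _ _).trans (by rw [norm_smul, Real.norm_eq_abs])
      _ ≤ ‖x - p‖ + δ * ‖n‖ := by gcongr; exact abs_le.2 ht
      _ = ‖x - p‖ + r / 2 := by rw [hδ]; field_simp
      _ < r := by linarith
  have hder : ∀ f : E → ℝ, ∀ x : E, ∀ t : ℝ, DifferentiableAt ℝ f (x + t • n) →
      HasDerivAt (fun t : ℝ => f (x + t • n)) (fderiv ℝ f (x + t • n) n) t := by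
    intro f x t hf
    have hl : HasDerivAt (fun t : ℝ => x + t • n) n t := by
      simpa using ((hasDerivAt_id t).smul_const n).const_add x
    exact HasFDerivAt.comp_hasDerivAt (l := f) t hf.hasFDerivAt hl
  have hmono : ∀ f : E → ℝ, (∀ x ∈ Metric.ball p r, DifferentiableAt ℝ f x ∧ 0 < fderiv ℝ f x n) →
      ∀ x ∈ Metric.ball p (r / 2), StrictMonoOn (fun t : ℝ => f (x + t • n)) (Set.Icc (-δ) δ) := by
    intro f hf x hx
    refine strictMonoOn_of_deriv_pos (convex_Icc _ _) (fun t ht =>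
      (hder f x t (hf _ (hmem x hx t ht)).1).continuousAt.continuousWithinAt) fun t ht => ?_
    have ht' := interior_subset ht
    rw [(hder f x t (hf _ (hmem x hx t ht')).1).deriv]
    exact (hf _ (hmem x hx t ht')).2
  have hρm := hmono ρ fun x hx => (hball x hx).1
  have hGm := hmono G fun x hx => (hball x hx).2.1
  have hpm : p ∈ Metric.ball p (r / 2) := Metric.mem_ball_self (by positivity)
  have h0 : (0 : ℝ) ∈ Set.Icc (-δ) δ := ⟨by linarith, hδpos.le⟩
  have hl : (-δ) ∈ Set.Icc (-δ) δ := ⟨le_rfl, by linarith⟩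
  have hr' : δ ∈ Set.Icc (-δ) δ := ⟨by linarith, le_rfl⟩
  have hneg : ρ (p + (-δ) • n) < 0 := by
    have := hρm p hpm hl h0 (by linarith)
    simpa [hp] using this
  have hpos : 0 < ρ (p + δ • n) := by
    have := hρm p hpm h0 hr' hδpos
    simpa [hp] using this
  have hc : ∀ t ∈ Set.Icc (-δ) δ, ContinuousAt (fun x => ρ (x + t • n)) p := fun t ht =>
    ContinuousAt.comp (g := ρ) (f := fun x => x + t • n)
      (hball _ (hmem p hpm t ht)).1.1.continuousAt (by fun_prop)
  filter_upwards [Metric.ball_mem_nhds p (half_pos hr), (hc _ hl).eventually_lt_const hneg,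
    (hc _ hr').eventually_const_lt hpos] with x hx h1 h2 hGx
  obtain ⟨t, ht, hρt⟩ := intermediate_value_Icc (f := fun t : ℝ => ρ (x + t • n))
    (by linarith : -δ ≤ δ) (fun t ht =>
      (hder ρ x t (hball _ (hmem x hx t ht)).1.1).continuousAt.continuousWithinAt)
    ⟨h1.le, h2.le⟩
  have hGt : G (x + t • n) = b := (hball _ (hmem x hx t ht)).2.2 hρt
  have : t = 0 := (hGm x hx).injOn ht h0 (by simp [hGt, hGx])
  simpa [this] using hρt

theorem hasFDerivAt_quadratic {E : Type*} [NormedAddCommGroup E] [InnerProductSpace ℝ E]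
    (A : ℝ) (B : E) (C : ℝ) (x : E) :
    HasFDerivAt (fun x : E => A * ‖x‖ ^ 2 + inner ℝ B x + C) (innerSL ℝ ((2 * A) • x + B)) x := by
  have h : HasFDerivAt (fun x : E => A * ‖x‖ ^ 2 + inner ℝ B x + C) _ x :=
    (((hasStrictFDerivAt_norm_sq x).hasFDerivAt.const_mul A).add
      (innerSL ℝ B).hasFDerivAt).add_const C
  refine h.congr_fderiv ?_
  ext v
  simp only [add_apply, smul_apply, innerSL_apply_apply, smul_eq_mul, nsmul_eq_mul,
    inner_add_left, real_inner_smul_left]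
  push_cast
  ring

theorem contDiff_quadratic {E : Type*} [NormedAddCommGroup E] [InnerProductSpace ℝ E]
    (A : ℝ) (B : E) (C : ℝ) : ContDiff ℝ ∞ (fun x : E => A * ‖x‖ ^ 2 + inner ℝ B x + C) :=
  ((contDiff_const.mul (contDiff_norm_sq ℝ)).add (innerSL ℝ B).contDiff).add contDiff_const

theorem hasFDerivAt_smul_add {E : Type*} [NormedAddCommGroup E] [NormedSpace ℝ E] (A : ℝ) (B x : E) :
    HasFDerivAt (fun x : E => (2 * A) • x + B) ((2 * A) • ContinuousLinearMap.id ℝ E) x :=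
  ((hasFDerivAt_id x).const_smul (2 * A)).add_const B

/-! ### The Euclidean unit normal of a level set -/

/-- The normalised Euclidean gradient `∇ρ / ‖∇ρ‖`. -/
def euclideanNormal {E : Type*} [NormedAddCommGroup E] [InnerProductSpace ℝ E] [CompleteSpace E]
    (ρ : E → ℝ) (x : E) : E :=
  ‖gradient ρ x‖⁻¹ • gradient ρ x

section Hypersurface

variable {E : Type*} [NormedAddCommGroup E] [InnerProductSpace ℝ E] [CompleteSpace E]

theorem fderiv_apply_eq_inner_euclideanNormal (ρ : E → ℝ) (x v : E) :
    fderiv ℝ ρ x v = ‖gradient ρ x‖ * inner ℝ (euclideanNormal ρ x) v := by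
  rw [← inner_gradient_left, euclideanNormal, real_inner_smul_left]
  by_cases h : gradient ρ x = 0
  · simp [h]
  · have : ‖gradient ρ x‖ ≠ 0 := norm_ne_zero_iff.2 h
    field_simp

theorem gradient_ne_zero_iff {ρ : E → ℝ} {x : E} : gradient ρ x ≠ 0 ↔ fderiv ℝ ρ x ≠ 0 := by
  rw [gradient, ne_eq, ne_eq, map_eq_zero_iff _ (LinearIsometryEquiv.injective _)]

theorem fderiv_apply_eq_zero_iff {ρ : E → ℝ} {x : E} (h : gradient ρ x ≠ 0) (v : E) :
    fderiv ℝ ρ x v = 0 ↔ inner ℝ (euclideanNormal ρ x) v = 0 := by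
  rw [fderiv_apply_eq_inner_euclideanNormal]
  simp [h]

theorem norm_euclideanNormal {ρ : E → ℝ} {x : E} (h : gradient ρ x ≠ 0) :
    ‖euclideanNormal ρ x‖ = 1 := by
  rw [euclideanNormal, norm_smul, norm_inv, norm_norm, inv_mul_cancel₀ (norm_ne_zero_iff.2 h)]

theorem contDiffAt_gradient {ρ : E → ℝ} {x : E} (hρ : ContDiffAt ℝ 2 ρ x) :
    ContDiffAt ℝ 1 (gradient ρ) x :=
  (InnerProductSpace.toDual ℝ E).symm.toContinuousLinearEquiv.contDiff.contDiffAt.comp x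
    (hρ.fderiv_right (by norm_num))

theorem differentiableAt_euclideanNormal {ρ : E → ℝ} {x : E} (hρ : ContDiffAt ℝ 2 ρ x)
    (h : gradient ρ x ≠ 0) : DifferentiableAt ℝ (euclideanNormal ρ) x := by
  have hg : DifferentiableAt ℝ (gradient ρ) x :=
    (contDiffAt_gradient hρ).differentiableAt (by simp)
  exact ((hg.norm ℝ h).inv (norm_ne_zero_iff.2 h)).smul hg

/-- The derivative of the unit normal is tangential. -/
theorem inner_euclideanNormal_fderiv {ρ : E → ℝ} {x : E} (hρ : ContDiffAt ℝ 2 ρ x)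
    (h : gradient ρ x ≠ 0) (v : E) :
    inner ℝ (euclideanNormal ρ x) (fderiv ℝ (euclideanNormal ρ) x v) = 0 := by
  have hd := (differentiableAt_euclideanNormal hρ h).hasFDerivAt
  have hev : (fun y => inner ℝ (euclideanNormal ρ y) (euclideanNormal ρ y)) =ᶠ[𝓝 x]
      fun _ => (1 : ℝ) := by
    filter_upwards [(contDiffAt_gradient hρ).continuousAt.eventually_ne h] with y hy
    rw [real_inner_self_eq_norm_sq, norm_euclideanNormal hy, one_pow]
  have h1 := hd.inner ℝ hd
  have h2 := h1.fderiv.symm.trans (hev.fderiv_eq.trans (hasFDerivAt_const (1 : ℝ) x).fderiv)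
  have h3 := DFunLike.congr_fun h2 v
  simp only [ContinuousLinearMap.comp_apply, ContinuousLinearMap.prod_apply,
    fderivInnerCLM_apply, zero_apply] at h3
  rw [real_inner_comm (euclideanNormal ρ x)] at h3
  linarith

/-! ### Straightening a hypersurface -/

/-- A map whose derivative at `p` is the identity has a local inverse. -/
theorem exists_localInverse_of_hasFDerivAt_id {Φ : E → E} {p : E} (hΦ : ContDiffAt ℝ 1 Φ p)
    (hd : HasFDerivAt Φ (ContinuousLinearMap.id ℝ E) p) {U : Set E} (hU : U ∈ 𝓝 p) :
    ∃ (Ψ : E → E) (r : ℝ), 0 < r ∧ Ψ (Φ p) = p ∧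
      HasFDerivAt Ψ (ContinuousLinearMap.id ℝ E) (Φ p) ∧
      (∀ z ∈ Metric.ball (Φ p) r, DifferentiableAt ℝ Ψ z ∧ Φ (Ψ z) = z ∧ Ψ z ∈ U) ∧
      ∀ᶠ x in 𝓝 p, Φ x ∈ Metric.ball (Φ p) r ∧ Ψ (Φ x) = x := by
  have hd' : HasFDerivAt Φ ((ContinuousLinearEquiv.refl ℝ E : E ≃L[ℝ] E) : E →L[ℝ] E) p := hd
  set e := hΦ.toOpenPartialHomeomorph Φ hd' one_ne_zero with he
  have hcoe : ∀ x, e x = Φ x := fun x => rfl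
  have hps : p ∈ e.source := hΦ.mem_toOpenPartialHomeomorph_source hd' one_ne_zero
  have hpt : Φ p ∈ e.target := hΦ.image_mem_toOpenPartialHomeomorph_target hd' one_ne_zero
  have hp : e.symm (Φ p) = p := e.left_inv hps
  have hΨ : ContDiffAt ℝ 1 e.symm (Φ p) :=
    e.contDiffAt_symm hpt (by rw [hp]; exact hd') (by rw [hp]; exact hΦ)
  have hΨd : HasFDerivAt e.symm (ContinuousLinearMap.id ℝ E) (Φ p) :=
    e.hasFDerivAt_symm hpt (f' := ContinuousLinearEquiv.refl ℝ E) (by rw [hp]; exact hd')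
  have hev : ∀ᶠ z in 𝓝 (Φ p), DifferentiableAt ℝ e.symm z ∧ Φ (e.symm z) = z ∧ e.symm z ∈ U := by
    have hU' : U ∈ 𝓝 (e.symm (Φ p)) := by rwa [hp]
    filter_upwards [hΨ.eventually (by simp), e.open_target.mem_nhds hpt,
      hΨ.continuousAt.preimage_mem_nhds hU'] with z h1 h2 h3
    exact ⟨h1.differentiableAt (by simp), e.right_inv h2, h3⟩
  obtain ⟨r, hr, hball⟩ := Metric.eventually_nhds_iff_ball.1 hev
  refine ⟨e.symm, r, hr, hp, hΨd, hball, ?_⟩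
  filter_upwards [e.open_source.mem_nhds hps,
    hΦ.continuousAt.preimage_mem_nhds (Metric.ball_mem_nhds _ hr)] with x h1 h2
  exact ⟨h2, e.left_inv h1⟩

/-- Near a regular point `p` of `ρ` there are coordinates `Φ`, with inverse `Ψ` and
with derivative the identity at `p`, in which `ρ` is the linear function `⟨a, ·⟩`.  If a
second function `W` has a gradient `v ≠ 0` at `p` orthogonal to that of `ρ`, then `W` can be made
linear at the same time. -/
theorem exists_straightening {ρ W : E → ℝ} {p a v : E} (hρ : ContDiffAt ℝ 1 ρ p)
    (hρ' : HasFDerivAt ρ (innerSL ℝ a) p) (ha : a ≠ 0) (hW : ContDiffAt ℝ 1 W p)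
    (hW' : HasFDerivAt W (innerSL ℝ v) p) (hav : inner ℝ a v = 0) {U : Set E} (hU : U ∈ 𝓝 p) :
    ∃ (Φ Ψ : E → E) (r : ℝ), 0 < r ∧ (∀ x, inner ℝ a (Φ x) = ρ x) ∧
      (v ≠ 0 → ∀ x, inner ℝ v (Φ x) = W x) ∧ Ψ (Φ p) = p ∧
      HasFDerivAt Ψ (ContinuousLinearMap.id ℝ E) (Φ p) ∧
      (∀ z ∈ Metric.ball (Φ p) r, DifferentiableAt ℝ Ψ z ∧ Φ (Ψ z) = z ∧ Ψ z ∈ U) ∧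
      ∀ᶠ x in 𝓝 p, Φ x ∈ Metric.ball (Φ p) r ∧ Ψ (Φ x) = x := by
  set Φ : E → E := fun x => x + (ρ x - inner ℝ a x) • ((‖a‖ ^ 2)⁻¹ • a)
    + (W x - inner ℝ v x) • ((‖v‖ ^ 2)⁻¹ • v) with hΦ
  have hΦc : ContDiffAt ℝ 1 Φ p :=
    (contDiffAt_id.add ((hρ.sub (innerSL ℝ a).contDiff.contDiffAt).smul contDiffAt_const)).add
      ((hW.sub (innerSL ℝ v).contDiff.contDiffAt).smul contDiffAt_const)
  have hΦd : HasFDerivAt Φ (ContinuousLinearMap.id ℝ E) p := by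
    have h := ((hasFDerivAt_id p).add ((hρ'.sub (innerSL ℝ a).hasFDerivAt).smul_const
      ((‖a‖ ^ 2)⁻¹ • a))).add ((hW'.sub (innerSL ℝ v).hasFDerivAt).smul_const ((‖v‖ ^ 2)⁻¹ • v))
    refine h.congr_fderiv ?_
    ext x
    simp
  obtain ⟨Ψ, r, hr, h1, h2, h3, h4⟩ := exists_localInverse_of_hasFDerivAt_id hΦc hΦd hU
  refine ⟨Φ, Ψ, r, hr, fun x => ?_, fun hv x => ?_, h1, h2, h3, h4⟩
  · have : ‖a‖ ≠ 0 := norm_ne_zero_iff.2 ha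
    simp only [hΦ, inner_add_right, real_inner_smul_right, hav, real_inner_self_eq_norm_sq]
    field_simp
    ring
  · have : ‖v‖ ≠ 0 := norm_ne_zero_iff.2 hv
    simp only [hΦ, inner_add_right, real_inner_smul_right, real_inner_comm a v, hav,
      real_inner_self_eq_norm_sq]
    field_simp
    ring

/-- `γ` is a differentiable curve in `{ρ = 0} ∩ U`, parametrised by `[0, 1]`, with tangential
velocity `γ'`. -/
structure IsLevelCurve (ρ : E → ℝ) (U : Set E) (γ γ' : ℝ → E) : Prop where
  hasDerivAt : ∀ t ∈ Set.Icc (0 : ℝ) 1, HasDerivAt γ (γ' t) t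
  level : ∀ t ∈ Set.Icc (0 : ℝ) 1, ρ (γ t) = 0
  mem : ∀ t ∈ Set.Icc (0 : ℝ) 1, γ t ∈ U
  tangent : ∀ t ∈ Set.Icc (0 : ℝ) 1, inner ℝ (euclideanNormal ρ (γ t)) (γ' t) = 0

/-- Segments in straightened coordinates are curves in the hypersurface. -/
theorem isLevelCurve_of_straightening {ρ : E → ℝ} {a z₀ z₁ z₂ : E} {r : ℝ} {U : Set E}
    {Φ Ψ : E → E} (hU : ∀ x ∈ U, DifferentiableAt ℝ ρ x ∧ gradient ρ x ≠ 0)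
    (hΦ : ∀ x, inner ℝ a (Φ x) = ρ x)
    (hΨ : ∀ z ∈ Metric.ball z₀ r, DifferentiableAt ℝ Ψ z ∧ Φ (Ψ z) = z ∧ Ψ z ∈ U)
    (h1 : z₁ ∈ Metric.ball z₀ r) (h2 : z₂ ∈ Metric.ball z₀ r)
    (h1a : inner ℝ a z₁ = 0) (h2a : inner ℝ a z₂ = 0) :
    IsLevelCurve ρ U (fun t => Ψ (AffineMap.lineMap z₁ z₂ t))
      (fun t => fderiv ℝ Ψ (AffineMap.lineMap z₁ z₂ t) (z₂ - z₁)) := by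
  have hball : ∀ t ∈ Set.Icc (0 : ℝ) 1, AffineMap.lineMap z₁ z₂ t ∈ Metric.ball z₀ r :=
    fun t ht => (convex_ball z₀ r).lineMap_mem h1 h2 ht
  have hlevel : ∀ t : ℝ, AffineMap.lineMap z₁ z₂ t ∈ Metric.ball z₀ r →
      ρ (Ψ (AffineMap.lineMap z₁ z₂ t)) = 0 := by
    intro t ht
    rw [← hΦ, (hΨ _ ht).2.1, AffineMap.lineMap_apply_module, inner_add_right,
      real_inner_smul_right, real_inner_smul_right, h1a, h2a]
    simp
  have hder : ∀ t ∈ Set.Icc (0 : ℝ) 1, HasDerivAt (fun t => Ψ (AffineMap.lineMap z₁ z₂ t))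
      (fderiv ℝ Ψ (AffineMap.lineMap z₁ z₂ t) (z₂ - z₁)) t := fun t ht =>
    (hΨ _ (hball t ht)).1.hasFDerivAt.comp_hasDerivAt t AffineMap.hasDerivAt_lineMap
  refine ⟨hder, fun t ht => hlevel t (hball t ht), fun t ht => (hΨ _ (hball t ht)).2.2,
    fun t ht => ?_⟩
  obtain ⟨hd, hg⟩ := hU _ (hΨ _ (hball t ht)).2.2
  rw [← fderiv_apply_eq_zero_iff hg]
  have h := hd.hasFDerivAt.comp_hasDerivAt t (hder t ht)
  have hev : (fun t => ρ (Ψ (AffineMap.lineMap z₁ z₂ t))) =ᶠ[𝓝 t] fun _ => 0 := by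
    have hc : ContinuousAt (fun t : ℝ => AffineMap.lineMap z₁ z₂ t) t :=
      (AffineMap.hasDerivAt_lineMap (𝕜 := ℝ)).continuousAt
    filter_upwards [hc.preimage_mem_nhds (Metric.isOpen_ball.mem_nhds (hball t ht))] with s hs
    exact hlevel s hs
  exact h.unique ((hasDerivAt_const t (0 : ℝ)).congr_of_eventuallyEq hev)

/-- Every point of `{ρ = 0}` near a regular point `p` is joined to `p` by a curve in `{ρ = 0}`. -/
theorem eventually_exists_isLevelCurve {ρ : E → ℝ} {p : E} {U : Set E} (hU : U ∈ 𝓝 p)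
    (hρ : ∀ x ∈ U, ContDiffAt ℝ 2 ρ x ∧ gradient ρ x ≠ 0) (hp : ρ p = 0) :
    ∀ᶠ x in 𝓝 p, ρ x = 0 → ∃ γ γ', IsLevelCurve ρ U γ γ' ∧ γ 0 = p ∧ γ 1 = x := by
  obtain ⟨hc, hg⟩ := hρ p (mem_of_mem_nhds hU)
  have hd : HasFDerivAt ρ (innerSL ℝ (gradient ρ p)) p := by
    refine (hc.differentiableAt (by simp)).hasFDerivAt.congr_fderiv ?_
    ext v
    simp
  obtain ⟨Φ, Ψ, r, hr, h1, -, h2, -, h3, h4⟩ := exists_straightening (W := fun _ => 0) (v := 0)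
    (hc.of_le (by norm_num)) hd hg contDiffAt_const (by simpa using hasFDerivAt_const (0 : ℝ) p)
    (by simp) hU
  filter_upwards [h4] with x hx hρx
  exact ⟨_, _, isLevelCurve_of_straightening
    (fun y hy => ⟨(hρ y hy).1.differentiableAt (by simp), (hρ y hy).2⟩) h1 h3
    (Metric.mem_ball_self hr) hx.1 (by rw [h1, hp]) (by rw [h1, hρx]), by simp [h2], by simp [hx.2]⟩

/-- A function whose derivative vanishes on the tangent spaces of `{ρ = 0}` is locally constant
there. -/
theorem eventually_eq_of_tangential_fderiv_eq_zero {ρ G : E → ℝ} {p : E} {U : Set E}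
    (hU : U ∈ 𝓝 p) (hρ : ∀ x ∈ U, ContDiffAt ℝ 2 ρ x ∧ gradient ρ x ≠ 0) (hp : ρ p = 0)
    (hG : ∀ x ∈ U, ρ x = 0 → DifferentiableAt ℝ G x ∧
      ∀ v, inner ℝ (euclideanNormal ρ x) v = 0 → fderiv ℝ G x v = 0) :
    ∀ᶠ x in 𝓝 p, ρ x = 0 → G x = G p := by
  filter_upwards [eventually_exists_isLevelCurve hU hρ hp] with x hx hρx
  obtain ⟨γ, γ', hγ, rfl, rfl⟩ := hx hρx
  have hder : ∀ t ∈ Set.Icc (0 : ℝ) 1, HasDerivAt (G ∘ γ) 0 t := by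
    intro t ht
    obtain ⟨h1, h2⟩ := hG _ (hγ.mem t ht) (hγ.level t ht)
    have := h1.hasFDerivAt.comp_hasDerivAt t (hγ.hasDerivAt t ht)
    rwa [h2 _ (hγ.tangent t ht)] at this
  exact eq_of_hasDerivAt_zero_Icc hder 1 (by simp)

/-- Every tangent vector of `{ρ = 0}` at a regular point is the velocity of a curve in
`{ρ = 0}`. -/
theorem exists_hasDerivAt_of_tangent {ρ : E → ℝ} {p X : E} (hρ : ContDiffAt ℝ 1 ρ p)
    (hg : gradient ρ p ≠ 0) (hp : ρ p = 0) (hX : inner ℝ (gradient ρ p) X = 0) :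
    ∃ γ : ℝ → E, γ 0 = p ∧ HasDerivAt γ X 0 ∧ ∀ᶠ t in 𝓝 0, ρ (γ t) = 0 := by
  have hd : HasFDerivAt ρ (innerSL ℝ (gradient ρ p)) p := by
    refine (hρ.differentiableAt (by simp)).hasFDerivAt.congr_fderiv ?_
    ext v
    simp
  obtain ⟨Φ, Ψ, r, hr, h1, -, h2, h2', h3, -⟩ := exists_straightening (W := fun _ => 0) (v := 0)
    hρ hd hg contDiffAt_const (by simpa using hasFDerivAt_const (0 : ℝ) p)
    (by simp) Filter.univ_mem
  have hl : HasDerivAt (fun t : ℝ => Φ p + t • X) X 0 := by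
    simpa using ((hasDerivAt_id (0 : ℝ)).smul_const X).const_add (Φ p)
  have h0 : Φ p + (0 : ℝ) • X = Φ p := by simp
  refine ⟨fun t => Ψ (Φ p + t • X), by simp [h2], ?_, ?_⟩
  · have := HasFDerivAt.comp_hasDerivAt (l := Ψ) (f := fun t : ℝ => Φ p + t • X) 0
      (by rw [h0]; exact h2') hl
    exact this
  · filter_upwards [hl.continuousAt.preimage_mem_nhds
      (Metric.isOpen_ball.mem_nhds (by rw [h0]; exact Metric.mem_ball_self hr))] with t ht
    rw [← h1, (h3 _ ht).2.1, inner_add_right, real_inner_smul_right, hX, h1, hp]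
    simp

/-! ### Hypersurfaces with a Robin condition are umbilic -/

/-- `{ρ = 0} ∩ U` is a regular hypersurface on which `W dN = ⟨V, N⟩` on tangent vectors. If `V` is
the gradient of `W`, which is not part of the definition, this is the Robin condition for `W`. -/
structure IsRobinHypersurface (ρ W : E → ℝ) (V : E → E) (U : Set E) : Prop where
  contDiffAt : ∀ x ∈ U, ContDiffAt ℝ 2 ρ x
  gradient_ne_zero : ∀ x ∈ U, gradient ρ x ≠ 0
  robin : ∀ x ∈ U, ρ x = 0 → ∀ X, inner ℝ (euclideanNormal ρ x) X = 0 →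
    W x • fderiv ℝ (euclideanNormal ρ) x X = inner ℝ (V x) (euclideanNormal ρ x) • X

theorem IsRobinHypersurface.mono {ρ W : E → ℝ} {V : E → E} {U U' : Set E}
    (h : IsRobinHypersurface ρ W V U) (hU : U' ⊆ U) : IsRobinHypersurface ρ W V U' :=
  ⟨fun x hx => h.1 x (hU hx), fun x hx => h.2 x (hU hx), fun x hx => h.3 x (hU hx)⟩

/-- If `V` is the gradient of `W` and `dV` is a multiple of the identity, then along a curve
in a Robin hypersurface that avoids the zeros of `W` the principal curvature `k = ⟨V, N⟩ / W` and
the vector `N - k x` are constant. Indeed `W d⟨V, N⟩ = ⟨V, W dN⟩ = ⟨V, N⟩ dW`. -/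
theorem IsLevelCurve.curvature_eq {ρ W : E → ℝ} {V : E → E} {α : ℝ} {U : Set E} {γ γ' : ℝ → E}
    (hγ : IsLevelCurve ρ U γ γ') (hU : IsRobinHypersurface ρ W V U)
    (hW : ∀ x, HasFDerivAt W (innerSL ℝ (V x)) x)
    (hV : ∀ x, HasFDerivAt V (α • ContinuousLinearMap.id ℝ E) x)
    (h0 : ∀ t ∈ Set.Icc (0 : ℝ) 1, W (γ t) ≠ 0) {k : ℝ}
    (hk : inner ℝ (V (γ 0)) (euclideanNormal ρ (γ 0)) = k * W (γ 0)) :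
    inner ℝ (V (γ 1)) (euclideanNormal ρ (γ 1)) = k * W (γ 1) ∧
      euclideanNormal ρ (γ 1) - k • γ 1 = euclideanNormal ρ (γ 0) - k • γ 0 := by
  have hNd : ∀ t ∈ Set.Icc (0 : ℝ) 1, HasDerivAt (fun t => euclideanNormal ρ (γ t))
      (fderiv ℝ (euclideanNormal ρ) (γ t) (γ' t)) t := fun t ht =>
    (differentiableAt_euclideanNormal (hU.1 _ (hγ.mem t ht))
      (hU.2 _ (hγ.mem t ht))).hasFDerivAt.comp_hasDerivAt t (hγ.hasDerivAt t ht)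
  have hkc : ∀ t ∈ Set.Icc (0 : ℝ) 1,
      inner ℝ (V (γ t)) (euclideanNormal ρ (γ t)) / W (γ t) = k := by
    intro t ht
    rw [eq_of_hasDerivAt_zero_Icc (g := fun t =>
      inner ℝ (V (γ t)) (euclideanNormal ρ (γ t)) / W (γ t)) ?_ t ht, hk,
      mul_div_assoc, div_self (h0 0 (by simp)), mul_one]
    intro t ht
    have hVd := (hV (γ t)).comp_hasDerivAt t (hγ.hasDerivAt t ht)
    have hWd := (hW (γ t)).comp_hasDerivAt t (hγ.hasDerivAt t ht)
    refine ((hVd.inner ℝ (hNd t ht)).div hWd (h0 t ht)).congr_deriv ?_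
    have hr := congrArg (inner ℝ (V (γ t)))
      (hU.robin _ (hγ.mem t ht) (hγ.level t ht) _ (hγ.tangent t ht))
    rw [real_inner_smul_right, real_inner_smul_right] at hr
    simp only [Function.comp, smul_apply, ContinuousLinearMap.id_apply, innerSL_apply_apply,
      real_inner_smul_left, real_inner_comm _ (γ' t), hγ.tangent t ht]
    rw [div_eq_zero_iff]
    left
    linear_combination hr
  have hq := hkc 1 (by simp)
  rw [div_eq_iff (h0 1 (by simp))] at hq
  refine ⟨hq, eq_of_hasDerivAt_zero_Icc (g := fun t => euclideanNormal ρ (γ t) - k • γ t)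
    (fun t ht => ?_) 1 (by simp)⟩
  refine ((hNd t ht).sub ((hγ.hasDerivAt t ht).const_smul k)).congr_deriv ?_
  have hr := hU.robin _ (hγ.mem t ht) (hγ.level t ht) _ (hγ.tangent t ht)
  rw [(div_eq_iff (h0 t ht)).1 (hkc t ht), mul_comm, mul_smul] at hr
  rw [smul_right_injective E (h0 t ht) hr, sub_self]

/-- A Robin hypersurface is locally totally umbilic with constant curvature, `N = k x + c`.

At a point `p` with `W p = 0` the zero set of `W` is transversal to the hypersurface. In
coordinates in which `ρ` and `W` are both linear, `{W > 0}` and `{W < 0}` are half-balls, on each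
of which `⟨V, N⟩ = k W` with some constant `k`; the two constants agree as `⟨V, N⟩` is differentiable
at `p`. -/
theorem IsRobinHypersurface.eventually_umbilic {ρ W : E → ℝ} {V : E → E} {α : ℝ} {U : Set E}
    {p : E} (hU : IsRobinHypersurface ρ W V U) (hpU : U ∈ 𝓝 p) (hp : ρ p = 0)
    (hWc : ContDiff ℝ 1 W) (hW : ∀ x, HasFDerivAt W (innerSL ℝ (V x)) x)
    (hV : ∀ x, HasFDerivAt V (α • ContinuousLinearMap.id ℝ E) x)
    (hnd : W p = 0 → V p ≠ 0) (hdim : ∃ X, X ≠ 0 ∧ inner ℝ (euclideanNormal ρ p) X = 0) :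
    ∃ (k : ℝ) (c : E), ∀ᶠ x in 𝓝 p, ρ x = 0 → euclideanNormal ρ x = k • x + c := by
  by_cases hWp : W p = 0
  swap
  · have hU'p : U ∩ {x | W x ≠ 0} ∈ 𝓝 p :=
      Filter.inter_mem hpU (hWc.continuous.continuousAt.eventually_ne hWp)
    have hU' := hU.mono (U' := U ∩ {x | W x ≠ 0}) Set.inter_subset_left
    set k := inner ℝ (V p) (euclideanNormal ρ p) / W p
    refine ⟨k, euclideanNormal ρ p - k • p, ?_⟩
    filter_upwards [eventually_exists_isLevelCurve hU'p (fun x hx => ⟨hU'.1 x hx, hU'.2 x hx⟩) hp]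
      with x hx hρx
    obtain ⟨γ, γ', hγ, h0, h1⟩ := hx hρx
    have := (hγ.curvature_eq hU' hW hV (fun t ht => (hγ.mem t ht).2) (k := k)
      (by rw [h0, div_mul_cancel₀ _ hWp])).2
    rw [h0, h1] at this
    rw [← this]
    abel
  have hp' := mem_of_mem_nhds hpU
  set a := gradient ρ p with ha
  set v := V p with hv
  have hv0 : v ≠ 0 := hnd hWp
  have hvn : ‖v‖ ^ 2 ≠ 0 := by positivity
  have ha0 : a ≠ 0 := hU.2 p hp'
  -- the Robin condition at a zero of `W` says that `V` is tangent to the hypersurface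
  have hav : inner ℝ a v = 0 := by
    obtain ⟨X, hX, hX'⟩ := hdim
    have := hU.robin p hp' hp X hX'
    rw [hWp, zero_smul, eq_comm, smul_eq_zero] at this
    have h := this.resolve_right hX
    rw [real_inner_comm] at h
    rw [inner_gradient_left, fderiv_apply_eq_inner_euclideanNormal, h, mul_zero]
  have hd : HasFDerivAt ρ (innerSL ℝ a) p := by
    refine ((hU.1 p hp').differentiableAt (by simp)).hasFDerivAt.congr_fderiv ?_
    ext v
    simp [ha]
  obtain ⟨Φ, Ψ, r, hr, h1, h2, h3, h3', h4, h5⟩ := exists_straightening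
    ((hU.1 p hp').of_le (by norm_num)) hd ha0 hWc.contDiffAt (hW p) hav hpU
  replace h2 := h2 hv0
  have hNc : ∀ z ∈ Metric.ball (Φ p) r, ContinuousAt (fun z => euclideanNormal ρ (Ψ z)) z :=
    fun z hz => ContinuousAt.comp (g := euclideanNormal ρ) (differentiableAt_euclideanNormal
      (hU.1 _ (h4 z hz).2.2) (hU.2 _ (h4 z hz).2.2)).continuousAt (h4 z hz).1.continuousAt
  have hap : inner ℝ a (Φ p) = 0 := by rw [h1, hp]
  have hvp : inner ℝ v (Φ p) = 0 := by rw [h2, hWp]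
  have hWz : ∀ z ∈ Metric.ball (Φ p) r, W (Ψ z) = inner ℝ v z := fun z hz => by
    rw [← h2, (h4 z hz).2.1]
  -- the line through `z` in the direction `v` is in the ball for small times
  have hline : ∀ (s : ℝ), ∀ z ∈ Metric.ball (Φ p) r,
      Filter.Tendsto (fun t : ℝ => z + (s * t) • v) (𝓝[>] 0) (𝓝 z) ∧
      ∀ᶠ t : ℝ in 𝓝[>] 0, z + (s * t) • v ∈ Metric.ball (Φ p) r := by
    intro s z hz
    have hc : Filter.Tendsto (fun t : ℝ => z + (s * t) • v) (𝓝 0) (𝓝 z) := by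
      have : Continuous fun t : ℝ => z + (s * t) • v := by fun_prop
      simpa using this.tendsto 0
    exact ⟨hc.mono_left nhdsWithin_le_nhds,
      (hc.eventually (Metric.isOpen_ball.mem_nhds hz)).filter_mono nhdsWithin_le_nhds⟩
  -- on each half-ball the curvature is constant
  have hhalf : ∀ s : ℝ, s ≠ 0 → ∃ (k : ℝ) (c : E), ∀ z ∈ Metric.ball (Φ p) r, inner ℝ a z = 0 →
      0 < s * inner ℝ v z → inner ℝ (V (Ψ z)) (euclideanNormal ρ (Ψ z)) = k * W (Ψ z) ∧
        euclideanNormal ρ (Ψ z) = k • Ψ z + c := by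
    intro s hs
    obtain ⟨t, ht, htpos⟩ :=
      ((hline s (Φ p) (Metric.mem_ball_self hr)).2.and self_mem_nhdsWithin).exists
    set z₁ := Φ p + (s * t) • v with hz₁
    have hz₁a : inner ℝ a z₁ = 0 := by
      rw [hz₁, inner_add_right, real_inner_smul_right, hap, hav]; simp
    have hz₁v : 0 < s * inner ℝ v z₁ := by
      have htpos' : 0 < t := htpos
      have : s * inner ℝ v z₁ = s ^ 2 * t * ‖v‖ ^ 2 := by
        rw [hz₁, inner_add_right, real_inner_smul_right, hvp, real_inner_self_eq_norm_sq]; ring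
      rw [this]
      positivity
    have hz₁W : W (Ψ z₁) ≠ 0 := by
      rw [hWz _ ht]
      rintro h
      simp [h] at hz₁v
    set k := inner ℝ (V (Ψ z₁)) (euclideanNormal ρ (Ψ z₁)) / W (Ψ z₁)
    refine ⟨k, euclideanNormal ρ (Ψ z₁) - k • Ψ z₁, fun z hz hza hzv => ?_⟩
    have hγ := isLevelCurve_of_straightening (U := U)
      (fun y hy => ⟨(hU.1 y hy).differentiableAt (by simp), hU.2 y hy⟩) h1 h4 ht hz hz₁a hza
    have hne : ∀ t ∈ Set.Icc (0 : ℝ) 1, W (Ψ (AffineMap.lineMap z₁ z t)) ≠ 0 := by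
      intro t' ht'
      rw [hWz _ ((convex_ball _ _).lineMap_mem ht hz ht')]
      have hpos : 0 < s * inner ℝ v (AffineMap.lineMap z₁ z t') := by
        rw [AffineMap.lineMap_apply_module, inner_add_right, real_inner_smul_right,
          real_inner_smul_right]
        rcases eq_or_lt_of_le ht'.1 with h | h
        · rw [← h]; simpa using hz₁v
        · have e1 : 0 ≤ (1 - t') * (s * inner ℝ v z₁) :=
            mul_nonneg (by linarith [ht'.2]) hz₁v.le
          have e2 : 0 < t' * (s * inner ℝ v z) := mul_pos h hzv
          linarith
      intro h
      rw [h, mul_zero] at hpos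
      exact lt_irrefl _ hpos
    have := hγ.curvature_eq hU hW hV hne (k := k) (by
      simp only [AffineMap.lineMap_apply_zero]
      rw [div_mul_cancel₀ _ hz₁W])
    simp only [AffineMap.lineMap_apply_zero, AffineMap.lineMap_apply_one] at this
    refine ⟨this.1, ?_⟩
    rw [← this.2]
    abel
  -- comparison of the slopes of `⟨V, N⟩` and of `W` at `p` identifies the constant
  set q : E → ℝ := fun z => inner ℝ (V (Ψ z)) (euclideanNormal ρ (Ψ z)) with hq
  have hqd : HasFDerivAt q (fderiv ℝ q (Φ p)) (Φ p) := by
    refine DifferentiableAt.hasFDerivAt ?_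
    have hVd : DifferentiableAt ℝ (fun z => V (Ψ z)) (Φ p) :=
      DifferentiableAt.comp (g := V) _ (hV _).differentiableAt h3'.differentiableAt
    have hNd : DifferentiableAt ℝ (fun z => euclideanNormal ρ (Ψ z)) (Φ p) :=
      DifferentiableAt.comp (g := euclideanNormal ρ) _ (by
        rw [h3]
        exact differentiableAt_euclideanNormal (hU.1 p hp') (hU.2 p hp')) h3'.differentiableAt
    exact hVd.inner ℝ hNd
  have hq0 : q (Φ p) = 0 := by
    simp only [hq, h3]
    rw [real_inner_comm, euclideanNormal, real_inner_smul_left, hav, mul_zero]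
  set κ := fderiv ℝ q (Φ p) v / ‖v‖ ^ 2 with hκ
  have hslope : ∀ s : ℝ, s ≠ 0 → ∀ k : ℝ, (∀ z ∈ Metric.ball (Φ p) r, inner ℝ a z = 0 →
      0 < s * inner ℝ v z → q z = k * W (Ψ z)) → k = κ := by
    intro s hs k hk
    have hl : HasDerivAt (fun t : ℝ => Φ p + (s * t) • v) (s • v) 0 := by
      simpa using (((hasDerivAt_id (0 : ℝ)).const_mul s).smul_const v).const_add (Φ p)
    have hd1 : HasDerivAt (fun t : ℝ => q (Φ p + (s * t) • v)) (fderiv ℝ q (Φ p) (s • v)) 0 :=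
      HasFDerivAt.comp_hasDerivAt (l := q) (f := fun t : ℝ => Φ p + (s * t) • v) 0
        (by simpa using hqd) hl
    have hd2 : HasDerivWithinAt (fun t : ℝ => q (Φ p + (s * t) • v)) (k * (s * ‖v‖ ^ 2))
        (Set.Ioi 0) 0 := by
      have : HasDerivAt (fun t : ℝ => t * (k * (s * ‖v‖ ^ 2))) (k * (s * ‖v‖ ^ 2)) 0 := by
        simpa using (hasDerivAt_id (0 : ℝ)).mul_const (k * (s * ‖v‖ ^ 2))
      refine this.hasDerivWithinAt.congr_of_eventuallyEq ?_ (by simp [hq0])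
      filter_upwards [(hline s (Φ p) (Metric.mem_ball_self hr)).2, self_mem_nhdsWithin]
        with t ht htpos
      have htpos' : 0 < t := htpos
      have e : inner ℝ v (Φ p + (s * t) • v) = s * t * ‖v‖ ^ 2 := by
        rw [inner_add_right, real_inner_smul_right, hvp, real_inner_self_eq_norm_sq]; ring
      rw [hk _ ht (by rw [inner_add_right, real_inner_smul_right, hap, hav]; simp)
        (by rw [e]; have : 0 < s ^ 2 * t * ‖v‖ ^ 2 := by positivity
            linarith), hWz _ ht, e]
      ring
    have := (uniqueDiffWithinAt_Ioi (0 : ℝ)).eq_deriv _ hd1.hasDerivWithinAt hd2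
    rw [map_smul, smul_eq_mul] at this
    rw [hκ, eq_div_iff hvn]
    exact (mul_left_cancel₀ hs (by linarith)).symm
  have hbdry : ∀ s : ℝ, s ≠ 0 → ∀ c : E, (∀ z ∈ Metric.ball (Φ p) r, inner ℝ a z = 0 →
      0 < s * inner ℝ v z → euclideanNormal ρ (Ψ z) = κ • Ψ z + c) →
      ∀ z ∈ Metric.ball (Φ p) r, inner ℝ a z = 0 → inner ℝ v z = 0 →
        euclideanNormal ρ (Ψ z) = κ • Ψ z + c := by
    intro s hs c hc z hz hza hzv
    obtain ⟨ht, hb⟩ := hline s z hz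
    refine tendsto_nhds_unique_of_eventuallyEq ((hNc z hz).tendsto.comp ht)
      ((((h4 z hz).1.continuousAt.const_smul κ).add continuousAt_const).tendsto.comp ht) ?_
    filter_upwards [hb, self_mem_nhdsWithin] with t ht htpos
    have htpos' : 0 < t := htpos
    refine hc _ ht (by rw [inner_add_right, real_inner_smul_right, hza, hav]; simp) ?_
    have : s * inner ℝ v (z + (s * t) • v) = s ^ 2 * t * ‖v‖ ^ 2 := by
      rw [inner_add_right, real_inner_smul_right, hzv, real_inner_self_eq_norm_sq]; ring
    rw [this]
    positivity
  have hall : ∀ s : ℝ, s ≠ 0 → ∀ z ∈ Metric.ball (Φ p) r, inner ℝ a z = 0 →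
      (0 < s * inner ℝ v z ∨ inner ℝ v z = 0) →
      euclideanNormal ρ (Ψ z) = κ • Ψ z + (euclideanNormal ρ p - κ • p) := by
    intro s hs
    obtain ⟨k, c, hkc⟩ := hhalf s hs
    obtain rfl : k = κ := hslope s hs k fun z hz hza hzv => (hkc z hz hza hzv).1
    have hb := hbdry s hs c fun z hz hza hzv => (hkc z hz hza hzv).2
    have hcp := hb (Φ p) (Metric.mem_ball_self hr) hap hvp
    rw [h3] at hcp
    have hc : c = euclideanNormal ρ p - κ • p := by rw [hcp]; abel
    rw [← hc]
    rintro z hz hza (hzv | hzv)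
    · exact (hkc z hz hza hzv).2
    · exact hb z hz hza hzv
  refine ⟨κ, euclideanNormal ρ p - κ • p, ?_⟩
  filter_upwards [h5] with x hx hρx
  have hax : inner ℝ a (Φ x) = 0 := by rw [h1, hρx]
  rw [← hx.2]
  rcases lt_trichotomy (inner ℝ v (Φ x)) 0 with h | h | h
  · exact hall (-1) (by norm_num) _ hx.1 hax (Or.inl (by linarith))
  · exact hall 1 one_ne_zero _ hx.1 hax (Or.inr h)
  · exact hall 1 one_ne_zero _ hx.1 hax (Or.inl (by linarith))

end Hypersurface

/-- On a level set of a function whose gradient `V` satisfies `dV = α`, the shape operator is the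
multiple `α / ‖V‖` of the identity. -/
theorem fderiv_euclideanNormal_of_gradient {E : Type*} [NormedAddCommGroup E]
    [InnerProductSpace ℝ E] [CompleteSpace E] {ρ : E → ℝ} {V : E → E} {α : ℝ}
    (hρ : ∀ x, HasFDerivAt ρ (innerSL ℝ (V x)) x)
    (hV : ∀ x, HasFDerivAt V (α • ContinuousLinearMap.id ℝ E) x) {x X : E} (hx : V x ≠ 0)
    (hX : inner ℝ (V x) X = 0) :
    fderiv ℝ (euclideanNormal ρ) x X = (‖V x‖⁻¹ * α) • X := by
  have hg : gradient ρ = V := by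
    funext y
    refine ext_inner_right ℝ fun v => ?_
    rw [inner_gradient_left, (hρ y).fderiv, innerSL_apply_apply]
  have hN : euclideanNormal ρ = fun y => ‖V y‖⁻¹ • V y := by
    funext y
    rw [euclideanNormal, hg]
  have hnd : HasFDerivAt (fun y => ‖V y‖) _ x :=
    ((hV x).differentiableAt.norm ℝ hx).hasFDerivAt
  -- `‖V‖` has a critical point in tangential directions
  have hn0 : fderiv ℝ (fun y => ‖V y‖) x X = 0 := by
    have h1 := (hnd.pow 2).unique (hV x).norm_sq
    have h2 := DFunLike.congr_fun h1 X
    simp only [smul_apply, ContinuousLinearMap.comp_apply, innerSL_apply_apply,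
      ContinuousLinearMap.id_apply, real_inner_smul_right, hX, smul_eq_mul, nsmul_eq_mul] at h2
    simpa [hx] using h2
  have hinv := (hasDerivAt_inv (norm_ne_zero_iff.2 hx)).comp_hasFDerivAt x hnd
  rw [hN]
  refine (DFunLike.congr_fun (hinv.smul (hV x)).fderiv X).trans ?_
  simp [hn0, smul_smul]

/-! ### Local defining functions -/

namespace Coord

section DefiningFunction

variable {ι : Type} [Fintype ι]

theorem IsLocalDefiningFunction.eventually {Ω : Set (EuclideanSpace ℝ ι)} {p : EuclideanSpace ℝ ι}
    {ρ : EuclideanSpace ℝ ι → ℝ} (h : IsLocalDefiningFunction Ω p ρ) :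
    ∀ᶠ x in 𝓝 p, IsLocalDefiningFunction Ω x ρ := by
  obtain ⟨U, hU, hpU, h1, h2, h3⟩ := h
  filter_upwards [hU.mem_nhds hpU] with x hx
  exact ⟨U, hU, hx, h1, h2, h3⟩

theorem IsLocalDefiningFunction.contDiffAt {Ω : Set (EuclideanSpace ℝ ι)} {p : EuclideanSpace ℝ ι}
    {ρ : EuclideanSpace ℝ ι → ℝ} (h : IsLocalDefiningFunction Ω p ρ) : ContDiffAt ℝ ∞ ρ p := by
  obtain ⟨U, hU, hpU, h1, h2, h3⟩ := h
  exact h1.contDiffAt (hU.mem_nhds hpU)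

theorem IsLocalDefiningFunction.differentiableAt {Ω : Set (EuclideanSpace ℝ ι)}
    {p : EuclideanSpace ℝ ι} {ρ : EuclideanSpace ℝ ι → ℝ} (h : IsLocalDefiningFunction Ω p ρ) :
    DifferentiableAt ℝ ρ p := h.contDiffAt.differentiableAt (by simp)

theorem IsLocalDefiningFunction.gradient_ne_zero {Ω : Set (EuclideanSpace ℝ ι)}
    {p : EuclideanSpace ℝ ι} {ρ : EuclideanSpace ℝ ι → ℝ} (h : IsLocalDefiningFunction Ω p ρ) :
    _root_.gradient ρ p ≠ 0 := by
  obtain ⟨U, hU, hpU, h1, h2, h3⟩ := h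
  exact gradient_ne_zero_iff.2 (h2 p hpU)

theorem IsLocalDefiningFunction.eventually_mem_iff {Ω : Set (EuclideanSpace ℝ ι)}
    {p : EuclideanSpace ℝ ι} {ρ : EuclideanSpace ℝ ι → ℝ} (h : IsLocalDefiningFunction Ω p ρ) :
    ∀ᶠ x in 𝓝 p, x ∈ Ω ↔ ρ x < 0 := by
  obtain ⟨U, hU, hpU, h1, h2, h3⟩ := h
  filter_upwards [hU.mem_nhds hpU] with x hx
  constructor
  · intro hxΩ
    exact (h3 ▸ ⟨hxΩ, hx⟩ : x ∈ {x ∈ U | ρ x < 0}).2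
  · intro hxρ
    exact (h3.symm ▸ ⟨hx, hxρ⟩ : x ∈ Ω ∩ U).1

/-- From a zero of a defining function, `Ω` is entered in every direction in which the defining
function decreases. -/
theorem IsLocalDefiningFunction.eventually_add_smul_mem {Ω : Set (EuclideanSpace ℝ ι)}
    {p v : EuclideanSpace ℝ ι} {ρ : EuclideanSpace ℝ ι → ℝ} (h : IsLocalDefiningFunction Ω p ρ)
    (hp : ρ p = 0) (hv : inner ℝ (euclideanNormal ρ p) v < 0) :
    ∀ᶠ t : ℝ in 𝓝[>] 0, p + t • v ∈ Ω := by
  have hv' : fderiv ℝ ρ p v < 0 := by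
    rw [fderiv_apply_eq_inner_euclideanNormal]
    exact mul_neg_of_pos_of_neg (norm_pos_iff.2 h.gradient_ne_zero) hv
  have hc : Filter.Tendsto (fun t : ℝ => p + t • v) (𝓝[>] 0) (𝓝 p) := by
    have : Continuous fun t : ℝ => p + t • v := by fun_prop
    simpa using (this.tendsto 0).mono_left (nhdsWithin_le_nhds (s := Set.Ioi 0))
  filter_upwards [eventually_neg_of_fderiv_neg h.differentiableAt hp hv',
    hc.eventually h.eventually_mem_iff] with t h1 h2
  exact h2.2 h1

theorem IsLocalDefiningFunction.mem_frontier_iff {Ω : Set (EuclideanSpace ℝ ι)} (hΩ : IsOpen Ω)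
    {p : EuclideanSpace ℝ ι} {ρ : EuclideanSpace ℝ ι → ℝ} (h : IsLocalDefiningFunction Ω p ρ) :
    p ∈ frontier Ω ↔ ρ p = 0 := by
  rw [hΩ.frontier_eq, Set.mem_sdiff, h.eventually_mem_iff.self_of_nhds, not_lt]
  constructor
  · rintro ⟨hcl, hp⟩
    refine le_antisymm (not_lt.1 fun hpos => ?_) hp
    obtain ⟨x, hx, h1, h2⟩ := ((mem_closure_iff_frequently.1 hcl).and_eventually
      (h.eventually_mem_iff.and (h.contDiffAt.continuousAt.eventually_const_lt hpos))).exists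
    exact absurd (h1.1 hx) (not_lt.2 h2.le)
  · intro hp
    refine ⟨?_, hp.ge⟩
    have hv : inner ℝ (euclideanNormal ρ p) (-euclideanNormal ρ p) < 0 := by
      rw [inner_neg_right, real_inner_self_eq_norm_sq, norm_euclideanNormal h.gradient_ne_zero]
      norm_num
    have hc : Filter.Tendsto (fun t : ℝ => p + t • (-euclideanNormal ρ p)) (𝓝[>] 0) (𝓝 p) := by
      have : Continuous fun t : ℝ => p + t • (-euclideanNormal ρ p) := by fun_prop
      simpa using (this.tendsto 0).mono_left (nhdsWithin_le_nhds (s := Set.Ioi 0))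
    exact mem_closure_of_tendsto hc (h.eventually_add_smul_mem hp hv)

/-- At a smooth boundary point the derivative within `Ω ∪ ∂Ω` is well defined: the tangent cone
contains an open half-space. -/
theorem IsLocalDefiningFunction.uniqueDiffWithinAt {Ω s : Set (EuclideanSpace ℝ ι)}
    {p : EuclideanSpace ℝ ι} {ρ : EuclideanSpace ℝ ι → ℝ} (h : IsLocalDefiningFunction Ω p ρ)
    (hp : ρ p = 0) (hs : Ω ⊆ s) (hps : p ∈ s) : UniqueDiffWithinAt ℝ s p := by
  refine ⟨?_, subset_closure hps⟩
  have hcone : ∀ v, inner ℝ (euclideanNormal ρ p) v < 0 → v ∈ tangentConeAt ℝ s p := by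
    intro v hv
    refine mem_tangentConeAt_of_add_smul_mem (l := 𝓝[>] (0 : ℝ)) (c := id)
      ?_ ?_
    · exact Filter.tendsto_id.mono_left (nhdsWithin_mono _ fun t (ht : 0 < t) => ne_of_gt ht)
    · filter_upwards [h.eventually_add_smul_mem hp hv] with t ht
      exact hs ht
  set n := euclideanNormal ρ p with hn
  have hnn : inner ℝ n n = (1 : ℝ) := by
    rw [real_inner_self_eq_norm_sq, norm_euclideanNormal h.gradient_ne_zero, one_pow]
  have hspan : Submodule.span ℝ (tangentConeAt ℝ s p) = ⊤ := by
    rw [eq_top_iff]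
    intro v _
    -- `v` is the difference of two vectors of the half-space
    have e : v = (v - (inner ℝ n v + 1) • n) - (-(inner ℝ n v + 1)) • n := by
      rw [neg_smul]; abel
    have h1 : (v - (inner ℝ n v + 1) • n) ∈ tangentConeAt ℝ s p := hcone _ (by
      rw [inner_sub_right, real_inner_smul_right, hnn]; linarith)
    have h2 : -n ∈ tangentConeAt ℝ s p := hcone _ (by rw [inner_neg_right, hnn]; norm_num)
    have h3 : n ∈ Submodule.span ℝ (tangentConeAt ℝ s p) := by
      simpa using Submodule.neg_mem _ (Submodule.subset_span h2)
    rw [e]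
    exact Submodule.sub_mem _ (Submodule.subset_span h1) (Submodule.smul_mem _ _ h3)
  rw [hspan]
  simp

/-- The unit normal does not depend on the defining function. -/
theorem IsLocalDefiningFunction.euclideanNormal_eq {Ω : Set (EuclideanSpace ℝ ι)} (hΩ : IsOpen Ω)
    {p : EuclideanSpace ℝ ι} {ρ₁ ρ₂ : EuclideanSpace ℝ ι → ℝ}
    (h₁ : IsLocalDefiningFunction Ω p ρ₁) (h₂ : IsLocalDefiningFunction Ω p ρ₂)
    (hp : p ∈ frontier Ω) : euclideanNormal ρ₁ p = euclideanNormal ρ₂ p := by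
  have hn₁ := norm_euclideanNormal h₁.gradient_ne_zero
  have hn₂ := norm_euclideanNormal h₂.gradient_ne_zero
  by_contra hne
  -- the direction `N₂ - N₁` would enter `Ω` for `ρ₁` and leave it for `ρ₂`
  have hle := real_inner_le_norm (euclideanNormal ρ₁ p) (euclideanNormal ρ₂ p)
  rw [hn₁, hn₂, mul_one] at hle
  have hlt : inner ℝ (euclideanNormal ρ₁ p) (euclideanNormal ρ₂ p) < (1 : ℝ) :=
    lt_of_le_of_ne hle fun h => hne ((inner_eq_one_iff_of_norm_eq_one hn₁ hn₂).1 h)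
  have hin := h₁.eventually_add_smul_mem (v := euclideanNormal ρ₂ p - euclideanNormal ρ₁ p)
    ((h₁.mem_frontier_iff hΩ).1 hp) (by
      rw [inner_sub_right, real_inner_self_eq_norm_sq, hn₁]; linarith)
  have hout : fderiv ℝ (fun x => -ρ₂ x) p (euclideanNormal ρ₂ p - euclideanNormal ρ₁ p) < 0 := by
    rw [fderiv_fun_neg, neg_apply, fderiv_apply_eq_inner_euclideanNormal, inner_sub_right,
      real_inner_self_eq_norm_sq, hn₂, real_inner_comm]
    have := mul_pos (norm_pos_iff.2 h₂.gradient_ne_zero) (sub_pos.2 hlt)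
    linarith
  have hout' := eventually_neg_of_fderiv_neg h₂.differentiableAt.neg
    (by simp [(h₂.mem_frontier_iff hΩ).1 hp]) hout
  have hc : Filter.Tendsto (fun t : ℝ => p + t • (euclideanNormal ρ₂ p - euclideanNormal ρ₁ p))
      (𝓝[>] 0) (𝓝 p) := by
    have : Continuous fun t : ℝ => p + t • (euclideanNormal ρ₂ p - euclideanNormal ρ₁ p) := by
      fun_prop
    simpa using (this.tendsto 0).mono_left (nhdsWithin_le_nhds (s := Set.Ioi 0))
  obtain ⟨t, h1, h2, h3⟩ := (hin.and (hout'.and (hc.eventually h₂.eventually_mem_iff))).exists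
  have := h3.1 h1
  rw [Pi.neg_apply] at h2
  linarith

/-- The shape operator does not depend on the defining function. -/
theorem IsLocalDefiningFunction.fderiv_euclideanNormal_eq {Ω : Set (EuclideanSpace ℝ ι)}
    (hΩ : IsOpen Ω) {p X : EuclideanSpace ℝ ι} {ρ₁ ρ₂ : EuclideanSpace ℝ ι → ℝ}
    (h₁ : IsLocalDefiningFunction Ω p ρ₁) (h₂ : IsLocalDefiningFunction Ω p ρ₂)
    (hp : p ∈ frontier Ω) (hX : inner ℝ (euclideanNormal ρ₁ p) X = 0) :
    fderiv ℝ (euclideanNormal ρ₁) p X = fderiv ℝ (euclideanNormal ρ₂) p X := by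
  have hX' : inner ℝ (_root_.gradient ρ₁ p) X = 0 := by
    rw [inner_gradient_left, fderiv_apply_eq_inner_euclideanNormal, hX, mul_zero]
  obtain ⟨γ, hγ0, hγ, hγρ⟩ := exists_hasDerivAt_of_tangent
    (h₁.contDiffAt.of_le (by norm_cast)) h₁.gradient_ne_zero
    ((h₁.mem_frontier_iff hΩ).1 hp) hX'
  have hd : ∀ ρ, IsLocalDefiningFunction Ω p ρ →
      HasDerivAt (fun t => euclideanNormal ρ (γ t)) (fderiv ℝ (euclideanNormal ρ) p X) 0 :=
    fun ρ h => HasFDerivAt.comp_hasDerivAt (l := euclideanNormal ρ) (f := γ) 0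
      (by
        rw [hγ0]
        exact (differentiableAt_euclideanNormal (h.contDiffAt.of_le (by norm_cast))
          h.gradient_ne_zero).hasFDerivAt) hγ
  refine (hd ρ₁ h₁).unique ((hd ρ₂ h₂).congr_of_eventuallyEq ?_)
  have hc : Filter.Tendsto γ (𝓝 0) (𝓝 p) := by
    simpa [hγ0] using hγ.continuousAt.tendsto
  filter_upwards [hγρ, hc.eventually h₁.eventually, hc.eventually h₂.eventually] with t h3 h4 h5
  exact h4.euclideanNormal_eq hΩ h5 ((h4.mem_frontier_iff hΩ).2 h3)

end DefiningFunction

end Coord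

/-! ### Partial derivatives -/

namespace Coord

/-- A partial derivative, read off from a Fréchet derivative. -/
theorem partialDeriv_eq_of_hasFDerivAt {ι : Type} [Fintype ι] [DecidableEq ι]
    {f : EuclideanSpace ℝ ι → ℝ} {f' : EuclideanSpace ℝ ι →L[ℝ] ℝ} {x : EuclideanSpace ℝ ι}
    (h : HasFDerivAt f f' x) (i : ι) : partialDeriv i f x = f' (EuclideanSpace.single i 1) := by
  rw [partialDeriv, h.fderiv]

theorem partialDeriv_congr {ι : Type} [Fintype ι] [DecidableEq ι]
    {f f' : EuclideanSpace ℝ ι → ℝ} {x : EuclideanSpace ℝ ι}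
    (h : f =ᶠ[𝓝 x] f') (i : ι) : partialDeriv i f x = partialDeriv i f' x := by
  rw [partialDeriv, h.fderiv_eq, partialDeriv]

theorem contDiffAt_partialDeriv {ι : Type} [Fintype ι] [DecidableEq ι]
    {f : EuclideanSpace ℝ ι → ℝ} {x : EuclideanSpace ℝ ι} {k l : WithTop ℕ∞}
    (h : ContDiffAt ℝ k f x) (hl : l + 1 ≤ k) (i : ι) : ContDiffAt ℝ l (partialDeriv i f) x :=
  (h.fderiv_right hl).clm_apply contDiffAt_const

theorem fderiv_apply_eq_sum {ι : Type} [Fintype ι] [DecidableEq ι]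
    (f : EuclideanSpace ℝ ι → ℝ) (x v : EuclideanSpace ℝ ι) :
    fderiv ℝ f x v = ∑ i, v i * partialDeriv i f x := by
  have : v = ∑ i, v i • EuclideanSpace.single i (1 : ℝ) := by
    ext j
    simp [Finset.sum_apply, Pi.single_apply]
  conv_lhs => rw [this]
  simp [partialDeriv]

theorem gradient_coord {ι : Type} [Fintype ι] [DecidableEq ι]
    (f : EuclideanSpace ℝ ι → ℝ) (x : EuclideanSpace ℝ ι) (i : ι) :
    (_root_.gradient f x) i = partialDeriv i f x := by
  have h : inner ℝ (_root_.gradient f x) (EuclideanSpace.single i 1) = partialDeriv i f x := by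
    rw [partialDeriv, _root_.gradient, InnerProductSpace.toDual_symm_apply]
  rw [← h, EuclideanSpace.inner_single_right]
  simp

theorem fderiv_eq_zero_of_partialDeriv {ι : Type} [Fintype ι] [DecidableEq ι]
    {f : EuclideanSpace ℝ ι → ℝ} {x : EuclideanSpace ℝ ι} (h : ∀ i, partialDeriv i f x = 0) :
    fderiv ℝ f x = 0 := by
  ext v
  rw [fderiv_apply_eq_sum]
  simp [h]

theorem partialDeriv_quadratic {ι : Type} [Fintype ι] [DecidableEq ι] (A : ℝ)
    (B : EuclideanSpace ℝ ι) (C : ℝ) (j : ι) (x : EuclideanSpace ℝ ι) :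
    partialDeriv j (fun x => A * ‖x‖ ^ 2 + inner ℝ B x + C) x = 2 * A * x j + B j := by
  rw [partialDeriv_eq_of_hasFDerivAt (hasFDerivAt_quadratic A B C x)]
  simp [EuclideanSpace.inner_single_right]

end Coord

/-! ### Curvature of the hyperbolic metric -/

namespace HalfSpace
open Coord

variable {m : ℕ}

theorem isOpen_hyperbolicSpace (m : ℕ) : IsOpen (hyperbolicSpace m) :=
  isOpen_lt continuous_const (by fun_prop)

theorem hyperbolicMetric_inv {x : EuclideanSpace ℝ (Fin (m + 1))} (hx : x ∈ hyperbolicSpace m) :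
    (hyperbolicMetric m x)⁻¹ = (x (Fin.last m)) ^ 2 • (1 : Matrix (Fin (m + 1)) (Fin (m + 1)) ℝ) := by
  have hx' : x (Fin.last m) ≠ 0 := ne_of_gt hx
  apply Matrix.inv_eq_right_inv
  simp [hyperbolicMetric, smul_smul, hx']

theorem hasFDerivAt_coord (k : Fin (m + 1)) (x : EuclideanSpace ℝ (Fin (m + 1))) :
    HasFDerivAt (fun y : EuclideanSpace ℝ (Fin (m + 1)) => y k)
      (EuclideanSpace.proj k : EuclideanSpace ℝ (Fin (m + 1)) →L[ℝ] ℝ) x :=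
  (EuclideanSpace.proj k : EuclideanSpace ℝ (Fin (m + 1)) →L[ℝ] ℝ).hasFDerivAt

theorem proj_single (k l : Fin (m + 1)) :
    (EuclideanSpace.proj k : EuclideanSpace ℝ (Fin (m + 1)) →L[ℝ] ℝ) (EuclideanSpace.single l 1)
      = if l = k then 1 else 0 := by
  simp [eq_comm]

theorem partialDeriv_hyperbolicMetric {x : EuclideanSpace ℝ (Fin (m + 1))}
    (hx : x ∈ hyperbolicSpace m) (l i j : Fin (m + 1)) :
    partialDeriv l (fun y => hyperbolicMetric m y i j) x =
      -2 * (x (Fin.last m))⁻¹ ^ 3 * (if i = j then 1 else 0) * (if l = Fin.last m then 1 else 0) := by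
  have hx' : x (Fin.last m) ≠ 0 := ne_of_gt hx
  have h := (((hasDerivAt_inv (pow_ne_zero 2 hx')).comp_hasFDerivAt x
    ((hasFDerivAt_coord (Fin.last m) x).pow 2))).mul_const
      ((1 : Matrix (Fin (m + 1)) (Fin (m + 1)) ℝ) i j)
  have h2 := partialDeriv_eq_of_hasFDerivAt h l
  have e : (fun y => hyperbolicMetric m y i j) = fun y : EuclideanSpace ℝ (Fin (m + 1)) =>
      ((fun t : ℝ => t⁻¹) ∘ (fun y : EuclideanSpace ℝ (Fin (m + 1)) => y (Fin.last m) ^ 2)) y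
        * (1 : Matrix (Fin (m + 1)) (Fin (m + 1)) ℝ) i j := by
    funext y
    simp [hyperbolicMetric]
  rw [e, h2]
  simp only [smul_apply, smul_eq_mul, Matrix.one_apply, proj_single]
  split_ifs <;> simp
  field_simp

/-- `Γᵏᵢⱼ = -(δₖⱼ eᵢ + δₖᵢ eⱼ - δᵢⱼ eₖ) / yₙ`, where `eᵢ = δᵢₙ`. -/
theorem christoffel_hyperbolicMetric {x : EuclideanSpace ℝ (Fin (m + 1))}
    (hx : x ∈ hyperbolicSpace m) (k i j : Fin (m + 1)) :
    christoffel (hyperbolicMetric m) k i j x = -((x (Fin.last m))⁻¹ *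
      ((if k = j then 1 else 0) * (if i = Fin.last m then 1 else 0)
        + (if k = i then 1 else 0) * (if j = Fin.last m then 1 else 0)
        - (if i = j then 1 else 0) * (if k = Fin.last m then 1 else 0))) := by
  have hx' : x (Fin.last m) ≠ 0 := ne_of_gt hx
  rw [christoffel]
  simp only [partialDeriv_hyperbolicMetric hx, hyperbolicMetric_inv hx]
  rw [Finset.sum_eq_single k (fun l _ hl => by simp [hl.symm]) (by simp)]
  simp only [Matrix.smul_apply, Matrix.one_apply_eq, smul_eq_mul]
  field_simp
  ring

theorem partialDeriv_christoffel_hyperbolicMetric {x : EuclideanSpace ℝ (Fin (m + 1))}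
    (hx : x ∈ hyperbolicSpace m) (l k i j : Fin (m + 1)) :
    partialDeriv l (christoffel (hyperbolicMetric m) k i j) x = (x (Fin.last m))⁻¹ ^ 2 *
      (if l = Fin.last m then 1 else 0) *
      ((if k = j then 1 else 0) * (if i = Fin.last m then 1 else 0)
        + (if k = i then 1 else 0) * (if j = Fin.last m then 1 else 0)
        - (if i = j then 1 else 0) * (if k = Fin.last m then 1 else 0)) := by
  have hx' : x (Fin.last m) ≠ 0 := ne_of_gt hx
  have hev := Filter.eventually_of_mem ((isOpen_hyperbolicSpace m).mem_nhds hx)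
    fun y hy => christoffel_hyperbolicMetric hy k i j
  rw [partialDeriv_congr hev]
  have h := ((((hasDerivAt_inv hx').comp_hasFDerivAt x
    (hasFDerivAt_coord (Fin.last m) x)).mul_const
      ((if k = j then 1 else 0) * (if i = Fin.last m then 1 else 0)
        + (if k = i then 1 else 0) * (if j = Fin.last m then 1 else 0)
        - (if i = j then 1 else 0) * (if k = Fin.last m then 1 else 0)))).neg
  refine (partialDeriv_eq_of_hasFDerivAt h l).trans ?_
  simp only [neg_apply, smul_apply, proj_single, smul_eq_mul]
  field_simp

/-- Hyperbolic space of dimension `m + 1` is Einstein: `Ric = -m g`. -/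
theorem ricci_hyperbolicMetric {x : EuclideanSpace ℝ (Fin (m + 1))}
    (hx : x ∈ hyperbolicSpace m) (i j : Fin (m + 1)) :
    ricci (hyperbolicMetric m) i j x = -(m : ℝ) * hyperbolicMetric m x i j := by
  rw [ricci]
  simp only [partialDeriv_christoffel_hyperbolicMetric hx, christoffel_hyperbolicMetric hx]
  simp only [hyperbolicMetric, Matrix.smul_apply, smul_eq_mul, Matrix.one_apply]
  generalize x (Fin.last m) = y
  simp only [mul_add, add_mul, mul_sub, sub_mul, Finset.sum_add_distrib, Finset.sum_sub_distrib,
    mul_ite, ite_mul, mul_one, mul_zero, zero_mul, neg_mul, mul_neg, Finset.sum_neg_distrib]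
  simp only [Finset.sum_ite_eq, Finset.sum_ite_eq', Finset.sum_ite_irrel, Finset.sum_neg_distrib,
    Finset.sum_add_distrib, Finset.sum_sub_distrib, Finset.sum_const, Finset.mem_univ, if_true,
    Finset.card_univ, Fintype.card_fin, nsmul_eq_mul]
  push_cast
  by_cases hi : i = Fin.last m
  · by_cases hj : j = Fin.last m
    · simp [hi, hj]
      ring
    · have hj' : ¬ Fin.last m = j := fun h => hj h.symm
      simp [hi, hj, hj']
  · have hi' : ¬ Fin.last m = i := fun h => hi h.symm
    by_cases hij : i = j
    · subst hij
      simp [hi, hi']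
      ring
    · have hji : ¬ j = i := fun h => hij h.symm
      by_cases hj : j = Fin.last m <;> simp [hi, hi', hij, hji]

theorem hessian_hyperbolicMetric {x : EuclideanSpace ℝ (Fin (m + 1))}
    (hx : x ∈ hyperbolicSpace m) (u : EuclideanSpace ℝ (Fin (m + 1)) → ℝ) (i j : Fin (m + 1)) :
    hessian (hyperbolicMetric m) u i j x = partialDeriv i (partialDeriv j u) x +
      (x (Fin.last m))⁻¹ * ((if i = Fin.last m then 1 else 0) * partialDeriv j u x
        + (if j = Fin.last m then 1 else 0) * partialDeriv i u x
        - (if i = j then 1 else 0) * partialDeriv (Fin.last m) u x) := by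
  rw [hessian]
  simp only [christoffel_hyperbolicMetric hx, neg_mul, Finset.sum_neg_distrib, sub_neg_eq_add,
    mul_assoc, ← Finset.mul_sum, add_mul, sub_mul, Finset.sum_add_distrib, Finset.sum_sub_distrib]
  congr 2
  simp [ite_mul]

/-- As the metric is Einstein, the static equation is equivalent to `Hess u = u g`. -/
theorem static_equation_iff {x : EuclideanSpace ℝ (Fin (m + 1))}
    (hm : 1 ≤ m) (hx : x ∈ hyperbolicSpace m) (u : EuclideanSpace ℝ (Fin (m + 1)) → ℝ) :
    (∀ i j, -(laplacian (hyperbolicMetric m) u x) * hyperbolicMetric m x i j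
        + hessian (hyperbolicMetric m) u i j x - u x * ricci (hyperbolicMetric m) i j x = 0) ↔
      ∀ i j, hessian (hyperbolicMetric m) u i j x = u x * hyperbolicMetric m x i j := by
  have hx' : x (Fin.last m) ≠ 0 := ne_of_gt hx
  have hm' : (m : ℝ) ≠ 0 := by positivity
  have hl : laplacian (hyperbolicMetric m) u x =
      x (Fin.last m) ^ 2 * ∑ i, hessian (hyperbolicMetric m) u i i x := by
    rw [laplacian, hyperbolicMetric_inv hx, Finset.mul_sum]
    refine Finset.sum_congr rfl fun i _ => ?_
    rw [Finset.sum_eq_single i (fun l _ hl => by simp [hl.symm]) (by simp)]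
    simp
  simp only [ricci_hyperbolicMetric hx]
  constructor
  · intro h
    -- the trace of the equation determines the Laplacian
    have ht : ∑ i, (-(laplacian (hyperbolicMetric m) u x) * hyperbolicMetric m x i i
        + hessian (hyperbolicMetric m) u i i x - u x * (-(m : ℝ) * hyperbolicMetric m x i i)) = 0 :=
      Finset.sum_eq_zero fun i _ => h i i
    have hlap : laplacian (hyperbolicMetric m) u x = (m + 1) * u x := by
      have h2 : ∑ i, hessian (hyperbolicMetric m) u i i x
          = (x (Fin.last m) ^ 2)⁻¹ * laplacian (hyperbolicMetric m) u x := by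
        rw [hl]; field_simp
      simp only [Finset.sum_add_distrib, Finset.sum_sub_distrib, h2, hyperbolicMetric,
        Matrix.smul_apply, Matrix.one_apply_eq, Finset.sum_const, Finset.card_univ,
        Fintype.card_fin, nsmul_eq_mul, smul_eq_mul] at ht
      push_cast at ht
      field_simp at ht
      have : (m : ℝ) * (laplacian (hyperbolicMetric m) u x - (m + 1) * u x) = 0 := by
        linear_combination -ht
      linarith [(mul_eq_zero.1 this).resolve_left hm']
    intro i j
    have := h i j
    rw [hlap] at this
    linear_combination this
  · intro h i j
    rw [hl]
    simp only [h]
    simp only [hyperbolicMetric,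
        Matrix.smul_apply, Matrix.one_apply_eq, Finset.sum_const, Finset.card_univ,
        Fintype.card_fin, nsmul_eq_mul, smul_eq_mul]
    push_cast
    field_simp
    ring

/-- The first derivatives of `w / yₙ`. -/
theorem partialDeriv_div_height {x : EuclideanSpace ℝ (Fin (m + 1))} (hx : x ∈ hyperbolicSpace m)
    {w : EuclideanSpace ℝ (Fin (m + 1)) → ℝ} (hw : DifferentiableAt ℝ w x) (j : Fin (m + 1)) :
    partialDeriv j (fun y => w y / y (Fin.last m)) x = partialDeriv j w x / x (Fin.last m)
      - w x * (if j = Fin.last m then 1 else 0) / x (Fin.last m) ^ 2 := by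
  have hx' : x (Fin.last m) ≠ 0 := ne_of_gt hx
  have h := hw.hasFDerivAt.mul ((hasDerivAt_inv hx').comp_hasFDerivAt x
    (hasFDerivAt_coord (Fin.last m) x))
  refine (partialDeriv_eq_of_hasFDerivAt h j).trans ?_
  simp only [add_apply, smul_apply, proj_single, smul_eq_mul, Function.comp, partialDeriv]
  field_simp
  ring

/-- For `u = w / yₙ`, the tensor `Hess u - u g` is the Euclidean Hessian of `w` minus `∂ₙ w / yₙ` times
the identity, divided by `yₙ`. -/
theorem hessian_div_height {x : EuclideanSpace ℝ (Fin (m + 1))} (hx : x ∈ hyperbolicSpace m)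
    {w : EuclideanSpace ℝ (Fin (m + 1)) → ℝ} (hw : ContDiffAt ℝ 2 w x) (i j : Fin (m + 1)) :
    hessian (hyperbolicMetric m) (fun y => w y / y (Fin.last m)) i j x
        - w x / x (Fin.last m) * hyperbolicMetric m x i j
      = (partialDeriv i (partialDeriv j w) x
        - (if i = j then 1 else 0) * (partialDeriv (Fin.last m) w x / x (Fin.last m)))
          / x (Fin.last m) := by
  have hx' : x (Fin.last m) ≠ 0 := ne_of_gt hx
  have hwd : DifferentiableAt ℝ w x := hw.differentiableAt (by simp)
  have hev : (partialDeriv j fun y => w y / y (Fin.last m)) =ᶠ[𝓝 x] fun y =>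
      partialDeriv j w y * (y (Fin.last m))⁻¹
        - w y * ((if j = Fin.last m then 1 else 0) * (y (Fin.last m))⁻¹ ^ 2) := by
    filter_upwards [(isOpen_hyperbolicSpace m).mem_nhds hx,
      (hw.eventually (by simp)).mono fun y hy => hy.differentiableAt (by simp)] with y hy hwy
    rw [partialDeriv_div_height hy hwy]
    ring
  have hinv := (hasDerivAt_inv hx').comp_hasFDerivAt x (hasFDerivAt_coord (Fin.last m) x)
  have hpd : DifferentiableAt ℝ (partialDeriv j w) x :=
    (contDiffAt_partialDeriv (l := 1) hw (by norm_num) j).differentiableAt (by simp)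
  have h := (hpd.hasFDerivAt.mul hinv).sub
    (hwd.hasFDerivAt.mul ((hinv.pow 2).const_mul (if j = Fin.last m then (1 : ℝ) else 0)))
  have h2 := (partialDeriv_congr hev i).trans (partialDeriv_eq_of_hasFDerivAt h i)
  rw [hessian_hyperbolicMetric hx, h2]
  simp only [partialDeriv_div_height hx hwd]
  simp only [add_apply, sub_apply, smul_apply, proj_single, smul_eq_mul, Function.comp,
    hyperbolicMetric, Matrix.smul_apply, Matrix.one_apply]
  simp only [partialDeriv, if_true, mul_one, show (2 - 1 : ℕ) = 1 from rfl, pow_one]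
  field_simp
  linear_combination (2 * w x * (if i = Fin.last m then 1 else 0)
    * (if j = Fin.last m then 1 else 0)) * mul_inv_cancel₀ hx'

/-! ### The normal and the second fundamental form of a hypersurface -/

theorem metricInner_hyperbolicMetric (x X Y : EuclideanSpace ℝ (Fin (m + 1))) :
    metricInner (hyperbolicMetric m) x X Y = (x (Fin.last m) ^ 2)⁻¹ * inner ℝ X Y := by
  rw [metricInner, PiLp.inner_apply, Finset.mul_sum]
  refine Finset.sum_congr rfl fun i _ => ?_
  rw [Finset.sum_eq_single i (fun l _ hl => by simp [hyperbolicMetric, hl.symm]) (by simp)]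
  simp [hyperbolicMetric]
  ring

/-- The hyperbolic unit normal is `yₙ` times the Euclidean one. -/
theorem unitNormal_hyperbolicMetric {x : EuclideanSpace ℝ (Fin (m + 1))}
    (hx : x ∈ hyperbolicSpace m) (ρ : EuclideanSpace ℝ (Fin (m + 1)) → ℝ) :
    unitNormal (hyperbolicMetric m) ρ x = x (Fin.last m) • euclideanNormal ρ x := by
  have hx0 : 0 < x (Fin.last m) := hx
  have hg : Coord.gradient (hyperbolicMetric m) ρ x =
      (x (Fin.last m) ^ 2) • _root_.gradient ρ x := by
    ext i
    rw [Coord.gradient, hyperbolicMetric_inv hx]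
    simp only [PiLp.smul_apply, gradient_coord]
    rw [Finset.sum_eq_single i (fun l _ hl => by simp [hl.symm]) (by simp)]
    simp
  have hs : metricInner (hyperbolicMetric m) x (Coord.gradient (hyperbolicMetric m) ρ x)
      (Coord.gradient (hyperbolicMetric m) ρ x) = (x (Fin.last m) * ‖_root_.gradient ρ x‖) ^ 2 := by
    rw [metricInner_hyperbolicMetric, hg, real_inner_self_eq_norm_sq, norm_smul, Real.norm_eq_abs,
      abs_of_pos (by positivity)]
    field_simp
  rw [unitNormal, hs, Real.sqrt_sq (by positivity), hg, euclideanNormal, smul_smul, smul_smul,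
    mul_inv]
  congr 1
  field_simp

/-- The hyperbolic second fundamental form in terms of the Euclidean shape operator `dN`. -/
theorem secondFundamentalForm_hyperbolicMetric {x : EuclideanSpace ℝ (Fin (m + 1))}
    (hx : x ∈ hyperbolicSpace m) {ρ : EuclideanSpace ℝ (Fin (m + 1)) → ℝ}
    (hN : DifferentiableAt ℝ (euclideanNormal ρ) x) {X Y : EuclideanSpace ℝ (Fin (m + 1))}
    (hX : inner ℝ (euclideanNormal ρ x) X = 0) :
    secondFundamentalForm (hyperbolicMetric m) ρ x X Y = (x (Fin.last m) ^ 2)⁻¹ *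
      (x (Fin.last m) * inner ℝ (fderiv ℝ (euclideanNormal ρ) x X) Y
        - euclideanNormal ρ x (Fin.last m) * inner ℝ X Y) := by
  have hx' : x (Fin.last m) ≠ 0 := ne_of_gt hx
  have hev : unitNormal (hyperbolicMetric m) ρ =ᶠ[𝓝 x]
      fun y => y (Fin.last m) • euclideanNormal ρ y :=
    Filter.eventually_of_mem ((isOpen_hyperbolicSpace m).mem_nhds hx)
      fun y hy => unitNormal_hyperbolicMetric hy ρ
  have hfd := hev.fderiv_eq.trans
    ((hasFDerivAt_coord (Fin.last m) x).smul hN.hasFDerivAt).fderiv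
  have hcov : covDeriv (hyperbolicMetric m) (unitNormal (hyperbolicMetric m) ρ) x X =
      x (Fin.last m) • fderiv ℝ (euclideanNormal ρ) x X
        - euclideanNormal ρ x (Fin.last m) • X := by
    ext k
    have hin : ∑ j, X j * euclideanNormal ρ x j = 0 := by
      rw [PiLp.inner_apply] at hX
      simpa using hX
    have hsum : ∑ i, ∑ j, christoffel (hyperbolicMetric m) k i j x * X i *
        (unitNormal (hyperbolicMetric m) ρ x) j = -(X (Fin.last m) * euclideanNormal ρ x k
          + X k * euclideanNormal ρ x (Fin.last m)) := by
      simp only [christoffel_hyperbolicMetric hx, unitNormal_hyperbolicMetric hx, PiLp.smul_apply,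
        smul_eq_mul]
      have : ∀ i j, -((x (Fin.last m))⁻¹ * ((if k = j then 1 else 0)
          * (if i = Fin.last m then 1 else 0) + (if k = i then 1 else 0)
          * (if j = Fin.last m then 1 else 0) - (if i = j then 1 else 0)
          * (if k = Fin.last m then 1 else 0))) * X i * (x (Fin.last m) * euclideanNormal ρ x j)
          = -((if i = Fin.last m then X i else 0) * (if k = j then euclideanNormal ρ x j else 0)
          + (if k = i then X i else 0) * (if j = Fin.last m then euclideanNormal ρ x j else 0)
          - (if i = j then X i * euclideanNormal ρ x j else 0)
            * (if k = Fin.last m then 1 else 0)) := by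
        intro i j
        split_ifs <;> field_simp <;> ring
      simp only [this, Finset.sum_neg_distrib, Finset.sum_sub_distrib, Finset.sum_add_distrib,
        ← Finset.mul_sum, ← Finset.sum_mul, Finset.sum_ite_eq, Finset.sum_ite_eq', Finset.mem_univ,
        if_true, hin]
      ring
    simp only [covDeriv, hsum, hfd, PiLp.sub_apply, PiLp.smul_apply, smul_eq_mul]
    simp
    ring
  rw [secondFundamentalForm, metricInner_hyperbolicMetric, hcov, inner_sub_left,
    real_inner_smul_left, real_inner_smul_left]

/-- For `u = W / yₙ` the boundary condition `u_ν ĝ = u h` is conformally invariant: the terms that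
involve the height cancel, and what remains is the Euclidean condition `W_N δ = W ⟨dN ·, ·⟩`. -/
theorem boundary_condition_iff {x : EuclideanSpace ℝ (Fin (m + 1))}
    (hx : x ∈ hyperbolicSpace m) {ρ W : EuclideanSpace ℝ (Fin (m + 1)) → ℝ}
    (hN : DifferentiableAt ℝ (euclideanNormal ρ) x) (hW : DifferentiableAt ℝ W x)
    {X Y : EuclideanSpace ℝ (Fin (m + 1))} (hX : inner ℝ (euclideanNormal ρ x) X = 0) :
    fderiv ℝ (fun y => W y / y (Fin.last m)) x (unitNormal (hyperbolicMetric m) ρ x)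
        * metricInner (hyperbolicMetric m) x X Y
      = W x / x (Fin.last m) * secondFundamentalForm (hyperbolicMetric m) ρ x X Y ↔
    fderiv ℝ W x (euclideanNormal ρ x) * inner ℝ X Y
      = W x * inner ℝ (fderiv ℝ (euclideanNormal ρ) x X) Y := by
  have hx' : x (Fin.last m) ≠ 0 := ne_of_gt hx
  have hd : fderiv ℝ (fun y => W y / y (Fin.last m)) x (euclideanNormal ρ x) =
      fderiv ℝ W x (euclideanNormal ρ x) / x (Fin.last m)
        - W x * euclideanNormal ρ x (Fin.last m) / x (Fin.last m) ^ 2 := by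
    have h : HasFDerivAt (fun y => W y / y (Fin.last m)) _ x :=
      hW.hasFDerivAt.mul ((hasDerivAt_inv hx').comp_hasFDerivAt x
        (hasFDerivAt_coord (Fin.last m) x))
    rw [h.fderiv]
    simp only [add_apply, smul_apply, smul_eq_mul, PiLp.proj_apply]
    field_simp
    ring
  rw [unitNormal_hyperbolicMetric hx, secondFundamentalForm_hyperbolicMetric hx hN hX,
    metricInner_hyperbolicMetric, map_smul, hd, smul_eq_mul]
  field_simp
  constructor
  · intro h
    refine mul_left_cancel₀ hx' ?_
    linear_combination h
  · intro h
    linear_combination x (Fin.last m) * h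

/-! ### The static potentials of the half-space -/

/-- On a connected open set, `∂ᵢ∂ⱼ w = δᵢⱼ ∂ₙ w / yₙ` forces `w = A |x|² + ⟨B, x⟩ + C` with `Bₙ = 0`:
the function `∂ₙ w / yₙ` has zero derivative, which determines first the gradient of `w` and
then `w` itself. -/
theorem exists_quadratic_of_hessian {Ω : Set (EuclideanSpace ℝ (Fin (m + 1)))} (hΩ : IsOpen Ω)
    (hc : IsConnected Ω) (hsub : Ω ⊆ hyperbolicSpace m)
    {w : EuclideanSpace ℝ (Fin (m + 1)) → ℝ} (hw : ∀ x ∈ Ω, ContDiffAt ℝ ∞ w x)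
    (h : ∀ x ∈ Ω, ∀ i j, partialDeriv i (partialDeriv j w) x =
      (if i = j then 1 else 0) * (partialDeriv (Fin.last m) w x / x (Fin.last m))) :
    ∃ (A : ℝ) (B : EuclideanSpace ℝ (Fin (m + 1))) (C : ℝ), B (Fin.last m) = 0 ∧
      ∀ x ∈ Ω, w x = A * ‖x‖ ^ 2 + inner ℝ B x + C := by
  have hpd : ∀ x ∈ Ω, ∀ j, DifferentiableAt ℝ (partialDeriv j w) x := fun x hx j =>
    (contDiffAt_partialDeriv (l := 1) (hw x hx) (by norm_cast) j).differentiableAt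
      (by simp)
  have hconst : ∀ f : EuclideanSpace ℝ (Fin (m + 1)) → ℝ, (∀ x ∈ Ω, DifferentiableAt ℝ f x) →
      (∀ x ∈ Ω, ∀ i, partialDeriv i f x = 0) → ∃ a, ∀ x ∈ Ω, f x = a := by
    intro f hf hf'
    obtain ⟨x₀, hx₀⟩ := hc.nonempty
    exact ⟨f x₀, fun x hx => hΩ.is_const_of_fderiv_eq_zero hc.isPreconnected
      (fun y hy => (hf y hy).differentiableWithinAt)
      (fun y hy => fderiv_eq_zero_of_partialDeriv (hf' y hy)) hx hx₀⟩
  obtain ⟨a, ha⟩ := hconst (fun x => partialDeriv (Fin.last m) w x / x (Fin.last m))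
    (fun x hx => by
      simp only [div_eq_mul_inv]
      exact (hpd x hx _).fun_mul
        ((hasFDerivAt_coord _ x).differentiableAt.fun_inv (ne_of_gt (hsub hx))))
    (fun x hx i => by
      have hx' : x (Fin.last m) ≠ 0 := ne_of_gt (hsub hx)
      rw [partialDeriv_div_height (hsub hx) (hpd x hx _), h x hx]
      field_simp
      ring)
  have hb : ∀ j, ∃ b, ∀ x ∈ Ω, partialDeriv j w x - a * x j = b := fun j =>
    hconst _ (fun x hx => (hpd x hx j).sub ((hasFDerivAt_coord j x).differentiableAt.const_mul a))
      (fun x hx i => by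
        refine (partialDeriv_eq_of_hasFDerivAt ((hpd x hx j).hasFDerivAt.sub
          ((hasFDerivAt_coord j x).const_mul a)) i).trans ?_
        have := h x hx i j
        rw [ha x hx] at this
        rw [sub_apply, smul_apply, proj_single, smul_eq_mul]
        rw [partialDeriv] at this
        rw [this]
        ring)
  choose b hb using hb
  set B : EuclideanSpace ℝ (Fin (m + 1)) := WithLp.toLp 2 b with hB
  have hwd : ∀ x ∈ Ω, DifferentiableAt ℝ w x := fun x hx => (hw x hx).differentiableAt (by simp)
  obtain ⟨C, hC⟩ := hconst (fun x => w x - (a / 2 * ‖x‖ ^ 2 + inner ℝ B x + 0))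
    (fun x hx => (hwd x hx).sub (hasFDerivAt_quadratic (a / 2) B 0 x).differentiableAt)
    (fun x hx i => by
      refine (partialDeriv_eq_of_hasFDerivAt ((hwd x hx).hasFDerivAt.sub
        (hasFDerivAt_quadratic (a / 2) B 0 x)) i).trans ?_
      have := hb i x hx
      rw [partialDeriv] at this
      simp only [sub_apply, innerSL_apply_apply, EuclideanSpace.inner_single_right]
      simp [hB]
      linarith)
  refine ⟨a / 2, B, C, ?_, fun x hx => by linarith [hC x hx]⟩
  obtain ⟨x₀, hx₀⟩ := hc.nonempty
  have h1 := hb (Fin.last m) x₀ hx₀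
  have h2 := ha x₀ hx₀
  rw [div_eq_iff (ne_of_gt (hsub hx₀))] at h2
  change b (Fin.last m) = 0
  linarith

/-! ### Euclidean spheres in the half-space -/

theorem abs_height_sub_le {c x : EuclideanSpace ℝ (Fin (m + 1))} {r : ℝ}
    (hx : x ∈ Metric.sphere c r) : |x (Fin.last m) - c (Fin.last m)| ≤ r := by
  rw [mem_sphere_iff_norm] at hx
  have := PiLp.norm_apply_le (x - c) (Fin.last m)
  rwa [hx, PiLp.sub_apply, Real.norm_eq_abs] at this

/-- The part of a Euclidean sphere in the half-space is connected. If the sphere is not contained in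
the half-space, project it from its lowest point `b = c - r eₙ`: it is the image of a convex subset
of the hyperplane `wₙ = 1` under `w ↦ b + (2 r / ‖w‖²) w`. -/
theorem isPreconnected_sphere_inter_hyperbolicSpace (hm : 1 ≤ m)
    (c : EuclideanSpace ℝ (Fin (m + 1))) {r : ℝ} (hr : 0 < r) :
    IsPreconnected (Metric.sphere c r ∩ hyperbolicSpace m) := by
  rcases lt_or_ge r (c (Fin.last m)) with hc | hc
  · rw [Set.inter_eq_left.2 fun x hx => ?_]
    · refine isPreconnected_sphere ?_ c r
      rw [← Module.finrank_eq_rank, finrank_euclideanSpace_fin]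
      exact_mod_cast (by omega : 1 < m + 1)
    · have := (abs_le.1 (abs_height_sub_le hx)).1
      change 0 < x (Fin.last m)
      linarith
  set e : EuclideanSpace ℝ (Fin (m + 1)) := EuclideanSpace.single (Fin.last m) 1 with he
  have hen : e (Fin.last m) = 1 := by simp [he]
  have hei : ∀ x : EuclideanSpace ℝ (Fin (m + 1)), inner ℝ x e = x (Fin.last m) := fun x => by
    simp [he, EuclideanSpace.inner_single_right]
  have hee : ‖e‖ = 1 := by simp [he]
  set T : Set (EuclideanSpace ℝ (Fin (m + 1))) :=
    {w | w (Fin.last m) = 1} ∩ {w | (r - c (Fin.last m)) * ‖w‖ ^ 2 < 2 * r} with hT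
  have hTc : Convex ℝ T := by
    refine Convex.inter ?_ ?_
    · exact convex_hyperplane (f := fun w : EuclideanSpace ℝ (Fin (m + 1)) => w (Fin.last m))
        (EuclideanSpace.proj (Fin.last m) : _ →L[ℝ] ℝ).toLinearMap.isLinear 1
    · have h1 : ConvexOn ℝ Set.univ fun w : EuclideanSpace ℝ (Fin (m + 1)) =>
          (r - c (Fin.last m)) * ‖w‖ ^ 2 :=
        (convexOn_univ_norm.pow (fun x _ => norm_nonneg x) 2).smul (by linarith)
      simpa using h1.convex_lt (2 * r)
  have hTn : ∀ w ∈ T, ‖w‖ ≠ 0 := by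
    rintro w ⟨hw, -⟩ h
    rw [norm_eq_zero] at h
    simp [h] at hw
  have himage : Metric.sphere c r ∩ hyperbolicSpace m =
      (fun w => c - r • e + (2 * r / ‖w‖ ^ 2) • w) '' T := by
    ext x
    constructor
    · rintro ⟨hx, hxn⟩
      rw [mem_sphere_iff_norm] at hx
      replace hxn : 0 < x (Fin.last m) := hxn
      set d := x - c + r • e with hd
      have hdn : d (Fin.last m) = x (Fin.last m) - c (Fin.last m) + r := by
        simp [hd, hen]
      have hd0 : 0 < d (Fin.last m) := by rw [hdn]; linarith
      have hdd : ‖d‖ ^ 2 = 2 * r * d (Fin.last m) := by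
        rw [hd, norm_add_sq_real, hx, real_inner_smul_right, hei, norm_smul, hee, ← hd, hdn,
          Real.norm_eq_abs, abs_of_pos hr, PiLp.sub_apply]
        ring
      have hw : ‖(d (Fin.last m))⁻¹ • d‖ ^ 2 = 2 * r / d (Fin.last m) := by
        rw [norm_smul, mul_pow, hdd, norm_inv, Real.norm_eq_abs, abs_of_pos hd0]
        field_simp
      refine ⟨(d (Fin.last m))⁻¹ • d, ⟨?_, ?_⟩, ?_⟩
      · simp [hd0.ne']
      · change (r - c (Fin.last m)) * ‖(d (Fin.last m))⁻¹ • d‖ ^ 2 < 2 * r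
        rw [hw, mul_div_assoc', div_lt_iff₀ hd0, hdn]
        nlinarith
      · change c - r • e + (2 * r / ‖(d (Fin.last m))⁻¹ • d‖ ^ 2) • (d (Fin.last m))⁻¹ • d = x
        rw [hw, smul_smul]
        have : 2 * r / (2 * r / d (Fin.last m)) * (d (Fin.last m))⁻¹ = 1 := by field_simp
        rw [this, one_smul, hd]
        abel
    · rintro ⟨w, hwT, rfl⟩
      have hw0 := hTn w hwT
      obtain ⟨hw1, hw2⟩ := hwT
      replace hw1 : w (Fin.last m) = 1 := hw1
      replace hw2 : (r - c (Fin.last m)) * ‖w‖ ^ 2 < 2 * r := hw2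
      refine ⟨?_, ?_⟩
      · rw [mem_sphere_iff_norm]
        have e1 : c - r • e + (2 * r / ‖w‖ ^ 2) • w - c = (2 * r / ‖w‖ ^ 2) • w - r • e := by abel
        rw [← sq_eq_sq₀ (norm_nonneg _) hr.le, e1, norm_sub_sq_real, real_inner_smul_left,
          real_inner_smul_right, hei, hw1, norm_smul, norm_smul, hee, mul_pow, mul_pow,
          Real.norm_eq_abs, Real.norm_eq_abs, sq_abs, sq_abs]
        field_simp
        ring
      · change 0 < (c - r • e + (2 * r / ‖w‖ ^ 2) • w) (Fin.last m)
        have hpos : 0 < ‖w‖ ^ 2 := by positivity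
        have : r - c (Fin.last m) < 2 * r / ‖w‖ ^ 2 := by rwa [lt_div_iff₀ hpos]
        simp only [PiLp.add_apply, PiLp.sub_apply, PiLp.smul_apply, hen, hw1, smul_eq_mul]
        linarith
  rw [himage]
  refine hTc.isPreconnected.image _ ?_
  have hcont : ContinuousOn (fun w : EuclideanSpace ℝ (Fin (m + 1)) => 2 * r / ‖w‖ ^ 2) T :=
    continuousOn_const.div (by fun_prop) fun w hw => pow_ne_zero 2 (hTn w hw)
  fun_prop

theorem convex_hyperbolicSpace (m : ℕ) : Convex ℝ (hyperbolicSpace m) :=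
  convex_halfSpace_gt (f := fun w : EuclideanSpace ℝ (Fin (m + 1)) => w (Fin.last m))
    (EuclideanSpace.proj (Fin.last m) : _ →L[ℝ] ℝ).toLinearMap.isLinear 0

/-- A Euclidean sphere that meets the half-space is a horosphere, a hypersphere or a geodesic
sphere, according to whether the height of its centre equals, is less than or exceeds its radius. -/
theorem sphere_inter_hyperbolicSpace_classification {c : EuclideanSpace ℝ (Fin (m + 1))} {r : ℝ}
    (hr : 0 < r) (hne : (Metric.sphere c r ∩ hyperbolicSpace m).Nonempty) :
    IsHorosphere m (Metric.sphere c r ∩ hyperbolicSpace m) ∨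
      IsHypersphere m (Metric.sphere c r ∩ hyperbolicSpace m) ∨
      IsGeodesicSphere m (Metric.sphere c r ∩ hyperbolicSpace m) := by
  rcases lt_trichotomy (c (Fin.last m)) r with h | h | h
  · refine Or.inr (Or.inl ⟨c, r, hr, ?_, rfl⟩)
    obtain ⟨x, hx, hxn⟩ := hne
    replace hxn : 0 < x (Fin.last m) := hxn
    have := (abs_le.1 (abs_height_sub_le hx)).2
    exact abs_lt.2 ⟨by linarith, h⟩
  · exact Or.inl ⟨c, r, hr, h, rfl⟩
  · have hsub : Metric.sphere c r ⊆ hyperbolicSpace m := fun x hx => by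
      have := (abs_le.1 (abs_height_sub_le hx)).1
      change 0 < x (Fin.last m)
      linarith
    exact Or.inr (Or.inr ⟨c, r, hr, hsub, Set.inter_eq_left.2 hsub⟩)

/-! ### Construction of the domains -/

theorem differentiableAt_div_height {x : EuclideanSpace ℝ (Fin (m + 1))}
    (hx : x ∈ hyperbolicSpace m) {W : EuclideanSpace ℝ (Fin (m + 1)) → ℝ}
    (hW : DifferentiableAt ℝ W x) :
    DifferentiableAt ℝ (fun y => W y / y (Fin.last m)) x := by
  simp only [div_eq_mul_inv]
  exact hW.fun_mul ((hasFDerivAt_coord _ x).differentiableAt.fun_inv (ne_of_gt hx))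

theorem contDiffOn_div_height {W : EuclideanSpace ℝ (Fin (m + 1)) → ℝ} (hW : ContDiff ℝ ∞ W) :
    ContDiffOn ℝ ∞ (fun y => W y / y (Fin.last m)) (hyperbolicSpace m) :=
  hW.contDiffOn.div
    (EuclideanSpace.proj (Fin.last m) : EuclideanSpace ℝ (Fin (m + 1)) →L[ℝ] ℝ).contDiff.contDiffOn
    fun _ hx => ne_of_gt hx

/-- The domain `{a |x|² + ⟨v, x⟩ + d < 0}` has the static potential `(⟨B, x⟩ + C) / yₙ` as soon
as `Bₙ = 0` and `2 a C = ⟨B, v⟩`. -/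
theorem isSimpleNonGenericDomain_quadratic (hm : 1 ≤ m) {a d C : ℝ}
    {v B : EuclideanSpace ℝ (Fin (m + 1))} {ρ : EuclideanSpace ℝ (Fin (m + 1)) → ℝ}
    (hρ : ρ = fun x => a * ‖x‖ ^ 2 + inner ℝ v x + d)
    (hreg : ∀ x ∈ hyperbolicSpace m, ρ x = 0 → (2 * a) • x + v ≠ 0)
    (hconn : IsConnected ({x | ρ x < 0} ∩ hyperbolicSpace m))
    (hbd : IsConnected ({x | ρ x = 0} ∩ hyperbolicSpace m))
    (hB : B (Fin.last m) = 0) (hC : 2 * a * C = inner ℝ B v) (hBC : B = 0 → C ≠ 0) :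
    IsSimpleNonGenericDomain (hyperbolicSpace m) (hyperbolicMetric m)
        ({x | ρ x < 0} ∩ hyperbolicSpace m) ∧
      boundaryIn (hyperbolicSpace m) ({x | ρ x < 0} ∩ hyperbolicSpace m)
        = {x | ρ x = 0} ∩ hyperbolicSpace m := by
  set Ω := {x | ρ x < 0} ∩ hyperbolicSpace m with hΩdef
  have hρs : ContDiff ℝ ∞ ρ := hρ ▸ contDiff_quadratic a v d
  have hρd : ∀ x, HasFDerivAt ρ (innerSL ℝ ((2 * a) • x + v)) x := fun x =>
    hρ ▸ hasFDerivAt_quadratic a v d x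
  have hM := isOpen_hyperbolicSpace m
  have hΩ : IsOpen Ω := (isOpen_lt hρs.continuous continuous_const).inter hM
  have hdef : ∀ p ∈ hyperbolicSpace m, ρ p = 0 → IsLocalDefiningFunction Ω p ρ := by
    intro p hp hp0
    refine ⟨hyperbolicSpace m ∩ {x | (2 * a) • x + v ≠ 0}, hM.inter (isOpen_ne_fun (by fun_prop)
      continuous_const), ⟨hp, hreg p hp hp0⟩, hρs.contDiffOn, fun x hx h => hx.2 ?_, ?_⟩
    · rw [(hρd x).fderiv] at h
      have := DFunLike.congr_fun h ((2 * a) • x + v)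
      rwa [innerSL_apply_apply, zero_apply, inner_self_eq_zero] at this
    · ext x
      simp only [hΩdef, Set.mem_inter_iff, Set.mem_ofPred_eq]
      tauto
  have hbdry : boundaryIn (hyperbolicSpace m) Ω = {x | ρ x = 0} ∩ hyperbolicSpace m := by
    ext p
    constructor
    · rintro ⟨hp, hpM⟩
      refine ⟨le_antisymm ?_ (not_lt.1 fun h => ?_), hpM⟩
      · exact closure_minimal (fun x hx => (le_of_lt hx.1 : ρ x ≤ 0))
          (isClosed_le hρs.continuous continuous_const) hp.1
      · rw [hΩ.frontier_eq] at hp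
        exact hp.2 ⟨h, hpM⟩
    · rintro ⟨hp, hpM⟩
      exact ⟨((hdef p hpM hp).mem_frontier_iff hΩ).2 hp, hpM⟩
  refine ⟨⟨⟨Set.inter_subset_right, hΩ, hconn, fun p hp => ?_⟩, hbdry ▸ hbd, ?_⟩, hbdry⟩
  · rw [hbdry] at hp
    exact ⟨ρ, hdef p hp.2 hp.1⟩
  set W : EuclideanSpace ℝ (Fin (m + 1)) → ℝ := fun x => 0 * ‖x‖ ^ 2 + inner ℝ B x + C with hW
  have hWs : ContDiff ℝ ∞ W := contDiff_quadratic 0 B C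
  refine ⟨fun x => W x / x (Fin.last m),
    (contDiffOn_div_height hWs).mono Set.inter_subset_right, ?_, ?_, ?_⟩
  · -- a non-zero affine function does not vanish on an open set
    by_contra! hcon
    have hW0 : ∀ x ∈ Ω, W x = 0 := fun x hx =>
      (div_eq_zero_iff.1 (hcon x hx)).resolve_right (ne_of_gt hx.2)
    obtain ⟨x₀, hx₀⟩ := hconn.nonempty
    have hev : W =ᶠ[𝓝 x₀] fun _ => 0 := Filter.eventually_of_mem (hΩ.mem_nhds hx₀) hW0
    have h1 := (hasFDerivAt_quadratic 0 B C x₀).unique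
      ((hasFDerivAt_const (0 : ℝ) x₀).congr_of_eventuallyEq hev)
    have h2 := DFunLike.congr_fun h1 B
    simp only [mul_zero, zero_smul, zero_add, innerSL_apply_apply, zero_apply,
      inner_self_eq_zero] at h2
    refine hBC h2 ?_
    have := hW0 x₀ hx₀
    simpa [hW, h2] using this
  · intro x hx
    refine (static_equation_iff hm hx.2 _).2 fun i j => ?_
    have h := hessian_div_height hx.2 (hWs.of_le (by norm_cast)).contDiffAt i j
    have hpd : ∀ k, partialDeriv k W = fun _ => B k := fun k => by
      funext y
      rw [hW, partialDeriv_quadratic]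
      ring
    rw [hpd, hpd, hB, partialDeriv] at h
    simp only [fderiv_fun_const] at h
    simp at h
    linarith
  · intro p hp
    have hp' := hp
    rw [hbdry] at hp'
    have hpd := hdef p hp'.2 hp'.1
    refine ⟨ρ, hpd, fun X Y hX hY => ?_⟩
    have hV0 := hreg p hp'.2 hp'.1
    have hWd : DifferentiableAt ℝ W p := hWs.contDiffAt.differentiableAt (by simp)
    rw [closureIn, (differentiableAt_div_height hp'.2 hWd).fderivWithin (hpd.uniqueDiffWithinAt hp'.1
      (Set.subset_inter subset_closure Set.inter_subset_right) ⟨frontier_subset_closure hp.1, hp.2⟩)]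
    have hXN : inner ℝ (euclideanNormal ρ p) X = 0 :=
      (fderiv_apply_eq_zero_iff hpd.gradient_ne_zero X).1 hX
    rw [boundary_condition_iff hp'.2 (differentiableAt_euclideanNormal
      (hpd.contDiffAt.of_le (by norm_cast)) hpd.gradient_ne_zero) hWd hXN,
      fderiv_euclideanNormal_of_gradient hρd (fun x => hasFDerivAt_smul_add a v x) hV0
        (by rwa [(hρd p).fderiv, innerSL_apply_apply] at hX), (hasFDerivAt_quadratic 0 B C p).fderiv]
    have hg : _root_.gradient ρ p = (2 * a) • p + v := by
      refine ext_inner_right ℝ fun w => ?_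
      rw [inner_gradient_left, (hρd p).fderiv, innerSL_apply_apply]
    rw [innerSL_apply_apply, euclideanNormal, hg, real_inner_smul_left, mul_zero, zero_smul,
      zero_add, real_inner_smul_right, inner_add_right, real_inner_smul_right, ← hC]
    simp only [hW]
    ring

theorem exists_domain_of_sphere (hm : 1 ≤ m) {c : EuclideanSpace ℝ (Fin (m + 1))} {r : ℝ}
    (hr : 0 < r) (hc : -r < c (Fin.last m)) :
    ∃ Ω : Set (EuclideanSpace ℝ (Fin (m + 1))),
      IsSimpleNonGenericDomain (hyperbolicSpace m) (hyperbolicMetric m) Ω ∧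
        boundaryIn (hyperbolicSpace m) Ω = Metric.sphere c r ∩ hyperbolicSpace m := by
  set ρ : EuclideanSpace ℝ (Fin (m + 1)) → ℝ :=
    fun x => 1 * ‖x‖ ^ 2 + inner ℝ ((-2 : ℝ) • c) x + (‖c‖ ^ 2 - r ^ 2) with hρ
  have hρ' : ∀ x, ρ x = ‖x - c‖ ^ 2 - r ^ 2 := fun x => by
    simp only [hρ]
    rw [norm_sub_sq_real, real_inner_smul_left, real_inner_comm]
    ring
  have hlt : {x | ρ x < 0} = Metric.ball c r := by
    ext x
    rw [Set.mem_ofPred_eq, hρ', mem_ball_iff_norm, sub_neg, sq_lt_sq₀ (norm_nonneg _) hr.le]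
  have heq : {x | ρ x = 0} = Metric.sphere c r := by
    ext x
    rw [Set.mem_ofPred_eq, hρ', mem_sphere_iff_norm, sub_eq_zero, sq_eq_sq₀ (norm_nonneg _) hr.le]
  set e : EuclideanSpace ℝ (Fin (m + 1)) := EuclideanSpace.single (Fin.last m) 1 with he
  have hee : ‖e‖ = 1 := by simp [he]
  have hen : e (Fin.last m) = 1 := by simp [he]
  -- the first coordinate differs from the height
  have h0 : (0 : Fin (m + 1)) ≠ Fin.last m := by
    rw [ne_eq, Fin.ext_iff]
    simp
    omega
  set s := max 0 (-c (Fin.last m)) with hs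
  have hsr : s < r := max_lt hr (by linarith)
  have hs0 : 0 ≤ s := le_max_left _ _
  have hs1 : -c (Fin.last m) ≤ s := le_max_right _ _
  have key := isSimpleNonGenericDomain_quadratic (a := 1) (v := (-2 : ℝ) • c) hm hρ
    (B := EuclideanSpace.single 0 1) (C := -c 0) ?_ ?_ ?_ (by simp [h0.symm])
    (by simp [EuclideanSpace.inner_single_left]) (by simp)
  · rw [heq] at key
    exact ⟨_, key⟩
  · intro x hx hx0 h
    have hxc : x = c := by
      have : (2 : ℝ) • (x - c) = 0 := by
        rw [← h, mul_one, smul_sub, neg_smul, sub_eq_add_neg]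
      exact sub_eq_zero.1 ((smul_eq_zero.1 this).resolve_left two_ne_zero)
    rw [hρ', hxc] at hx0
    simp at hx0
    exact hr.ne' hx0
  · rw [hlt]
    refine ⟨⟨c + ((s + r) / 2) • e, ?_, ?_⟩,
      ((convex_ball c r).inter (convex_hyperbolicSpace m)).isPreconnected⟩
    · rw [mem_ball_iff_norm, add_sub_cancel_left, norm_smul, hee, Real.norm_eq_abs,
        abs_of_pos (by linarith)]
      linarith
    · change 0 < (c + ((s + r) / 2) • e) (Fin.last m)
      simp only [PiLp.add_apply, PiLp.smul_apply, hen, smul_eq_mul]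
      linarith
  · rw [heq]
    refine ⟨⟨c + r • e, ?_, ?_⟩, isPreconnected_sphere_inter_hyperbolicSpace hm c hr⟩
    · rw [mem_sphere_iff_norm, add_sub_cancel_left, norm_smul, hee, Real.norm_eq_abs,
        abs_of_pos hr, mul_one]
    · change 0 < (c + r • e) (Fin.last m)
      simp only [PiLp.add_apply, PiLp.smul_apply, hen, smul_eq_mul]
      linarith

theorem convex_inner_eq (a : EuclideanSpace ℝ (Fin (m + 1))) (b : ℝ) :
    Convex ℝ ({y | inner ℝ a y = b} ∩ hyperbolicSpace m) :=
  (convex_hyperplane (innerSL ℝ a).toLinearMap.isLinear b).inter (convex_hyperbolicSpace m)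

theorem exists_domain_of_hyperplane (hm : 1 ≤ m) {a : EuclideanSpace ℝ (Fin (m + 1))} {b : ℝ}
    (ha : a ≠ 0) (hne : ({y | inner ℝ a y = b} ∩ hyperbolicSpace m).Nonempty) :
    ∃ Ω : Set (EuclideanSpace ℝ (Fin (m + 1))),
      IsSimpleNonGenericDomain (hyperbolicSpace m) (hyperbolicMetric m) Ω ∧
        boundaryIn (hyperbolicSpace m) Ω = {y | inner ℝ a y = b} ∩ hyperbolicSpace m := by
  set ρ : EuclideanSpace ℝ (Fin (m + 1)) → ℝ :=
    fun x => 0 * ‖x‖ ^ 2 + inner ℝ a x + (-b) with hρ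
  have hlt : {x | ρ x < 0} = {x | inner ℝ a x < b} := by
    ext x
    simp only [hρ, Set.mem_ofPred_eq]
    constructor <;> intro h <;> linarith
  have heq : {x | ρ x = 0} = {x | inner ℝ a x = b} := by
    ext x
    simp only [hρ, Set.mem_ofPred_eq]
    constructor <;> intro h <;> linarith
  have key := isSimpleNonGenericDomain_quadratic (a := 0) (v := a) hm hρ
    (B := 0) (C := 1) (by simp [ha]) ?_ ?_ (by simp) (by simp) (by simp)
  · rw [heq] at key
    exact ⟨_, key⟩
  · rw [hlt]
    refine ⟨?_, ((convex_halfSpace_lt (innerSL ℝ a).toLinearMap.isLinear b).inter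
      (convex_hyperbolicSpace m)).isPreconnected⟩
    obtain ⟨x, hx, hxM⟩ := hne
    -- move a little from a point of the hyperplane in the direction `-a`
    have hc : Filter.Tendsto (fun t : ℝ => x - t • a) (𝓝[>] 0) (𝓝 x) := by
      have : Continuous fun t : ℝ => x - t • a := by fun_prop
      simpa using (this.tendsto 0).mono_left (nhdsWithin_le_nhds (s := Set.Ioi 0))
    obtain ⟨t, ht, htpos⟩ := ((hc.eventually ((isOpen_hyperbolicSpace m).mem_nhds hxM)).and
      self_mem_nhdsWithin).exists
    refine ⟨x - t • a, ?_, ht⟩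
    replace hx : inner ℝ a x = b := hx
    replace htpos : 0 < t := htpos
    have : 0 < t * ‖a‖ ^ 2 := by positivity
    change inner ℝ a (x - t • a) < b
    rw [inner_sub_right, real_inner_smul_right, hx, real_inner_self_eq_norm_sq]
    linarith
  · rw [heq]
    exact ⟨hne, (convex_inner_eq a b).isPreconnected⟩

/-! ### The boundary of a simple non-generic domain -/

/-- A static potential is `(A |x|² + ⟨B, x⟩ + C) / yₙ` with `Bₙ = 0`, up to the boundary. -/
theorem exists_quadratic_of_isStaticPotential (hm : 1 ≤ m)
    {Ω : Set (EuclideanSpace ℝ (Fin (m + 1)))} {u : EuclideanSpace ℝ (Fin (m + 1)) → ℝ}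
    (hΩ : IsSmoothDomain (hyperbolicSpace m) Ω)
    (hu : IsStaticPotential (hyperbolicSpace m) (hyperbolicMetric m) Ω u) :
    ∃ (A : ℝ) (B : EuclideanSpace ℝ (Fin (m + 1))) (C : ℝ), B (Fin.last m) = 0 ∧
      ∀ x ∈ closureIn (hyperbolicSpace m) Ω,
        u x = (A * ‖x‖ ^ 2 + inner ℝ B x + C) / x (Fin.last m) := by
  have hsub : Ω ⊆ closureIn (hyperbolicSpace m) Ω := Set.subset_inter subset_closure hΩ.subset
  set w : EuclideanSpace ℝ (Fin (m + 1)) → ℝ := fun x => x (Fin.last m) * u x with hw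
  have huw : ∀ x ∈ hyperbolicSpace m, u x = w x / x (Fin.last m) := fun x hx => by
    have : x (Fin.last m) ≠ 0 := ne_of_gt hx
    simp only [hw]
    field_simp
  have hwc : ∀ x ∈ Ω, ContDiffAt ℝ ∞ w x := fun x hx =>
    (EuclideanSpace.proj (Fin.last m) :
      EuclideanSpace ℝ (Fin (m + 1)) →L[ℝ] ℝ).contDiff.contDiffAt.mul
      (hu.smooth.contDiffAt (Filter.mem_of_superset (hΩ.isOpen.mem_nhds hx) hsub))
  obtain ⟨A, B, C, hB, hABC⟩ := exists_quadratic_of_hessian hΩ.isOpen hΩ.isConnected hΩ.subset hwc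
    (fun x hx i j => by
      have hxM := hΩ.subset hx
      have hx' : x (Fin.last m) ≠ 0 := ne_of_gt hxM
      have hev : u =ᶠ[𝓝 x] fun y => w y / y (Fin.last m) :=
        Filter.eventually_of_mem ((isOpen_hyperbolicSpace m).mem_nhds hxM) huw
      have h1 := (static_equation_iff hm hxM u).1 (hu.interior_eq x hx) i j
      have h2 := hessian_div_height hxM ((hwc x hx).of_le (by norm_cast)) i j
      have h3 : hessian (hyperbolicMetric m) u i j x =
          hessian (hyperbolicMetric m) (fun y => w y / y (Fin.last m)) i j x := by
        have hev' : partialDeriv j u =ᶠ[𝓝 x] partialDeriv j fun y => w y / y (Fin.last m) :=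
          hev.eventually_nhds.mono fun y hy => partialDeriv_congr hy j
        rw [hessian, hessian, partialDeriv_congr hev' i]
        simp only [partialDeriv_congr hev]
      rw [← h3, h1, huw x hxM, sub_self, eq_comm, div_eq_zero_iff] at h2
      exact sub_eq_zero.1 (h2.resolve_right hx'))
  refine ⟨A, B, C, hB, ?_⟩
  have heq : Set.EqOn u (fun x => (A * ‖x‖ ^ 2 + inner ℝ B x + C) / x (Fin.last m)) Ω :=
    fun x hx => by
      rw [huw x (hΩ.subset hx), hABC x hx]
  exact heq.of_subset_closure hu.smooth.continuousOn
    ((contDiffOn_div_height (contDiff_quadratic A B C)).continuousOn.mono Set.inter_subset_right)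
    hsub Set.inter_subset_left

/-- The boundary condition for a static potential `W / yₙ` is the Euclidean Robin condition
for `W`, with respect to every local defining function. -/
theorem robin_of_isStaticPotential {Ω : Set (EuclideanSpace ℝ (Fin (m + 1)))}
    {u : EuclideanSpace ℝ (Fin (m + 1)) → ℝ} (hΩ : IsSmoothDomain (hyperbolicSpace m) Ω)
    (hu : IsStaticPotential (hyperbolicSpace m) (hyperbolicMetric m) Ω u) {A C : ℝ}
    {B : EuclideanSpace ℝ (Fin (m + 1))}
    (huW : ∀ x ∈ closureIn (hyperbolicSpace m) Ω,
        u x = (A * ‖x‖ ^ 2 + inner ℝ B x + C) / x (Fin.last m))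
    {p X : EuclideanSpace ℝ (Fin (m + 1))} (hp : p ∈ boundaryIn (hyperbolicSpace m) Ω)
    {ρ : EuclideanSpace ℝ (Fin (m + 1)) → ℝ} (hρ : IsLocalDefiningFunction Ω p ρ)
    (hX : inner ℝ (euclideanNormal ρ p) X = 0) :
    (A * ‖p‖ ^ 2 + inner ℝ B p + C) • fderiv ℝ (euclideanNormal ρ) p X
      = inner ℝ ((2 * A) • p + B) (euclideanNormal ρ p) • X := by
  obtain ⟨ρ', hρ', hbd⟩ := hu.boundary_eq p hp
  rw [hρ.fderiv_euclideanNormal_eq hΩ.isOpen hρ' hp.1 hX]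
  have hN := hρ.euclideanNormal_eq hΩ.isOpen hρ' hp.1
  rw [hN] at hX ⊢
  set W : EuclideanSpace ℝ (Fin (m + 1)) → ℝ := fun x => A * ‖x‖ ^ 2 + inner ℝ B x + C with hW
  have hWd : DifferentiableAt ℝ W p := (hasFDerivAt_quadratic A B C p).differentiableAt
  have hpc : p ∈ closureIn (hyperbolicSpace m) Ω := ⟨frontier_subset_closure hp.1, hp.2⟩
  have hfd : fderivWithin ℝ u (closureIn (hyperbolicSpace m) Ω) p =
      fderiv ℝ (fun x => W x / x (Fin.last m)) p := by
    rw [fderivWithin_congr huW (huW p hpc)]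
    exact (differentiableAt_div_height hp.2 hWd).fderivWithin
      (hρ'.uniqueDiffWithinAt ((hρ'.mem_frontier_iff hΩ.isOpen).1 hp.1)
        (Set.subset_inter subset_closure hΩ.subset) hpc)
  have hNd := differentiableAt_euclideanNormal (hρ'.contDiffAt.of_le (by norm_cast))
    hρ'.gradient_ne_zero
  have key : ∀ Y, inner ℝ (euclideanNormal ρ' p) Y = 0 →
      inner ℝ ((2 * A) • p + B) (euclideanNormal ρ' p) * inner ℝ X Y
        = W p * inner ℝ (fderiv ℝ (euclideanNormal ρ') p X) Y := by
    intro Y hY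
    have h := hbd X Y ((fderiv_apply_eq_zero_iff hρ'.gradient_ne_zero X).2 hX)
      ((fderiv_apply_eq_zero_iff hρ'.gradient_ne_zero Y).2 hY)
    rw [hfd, huW p hpc] at h
    have h2 := (boundary_condition_iff hp.2 hNd hWd hX).1 h
    rwa [(hasFDerivAt_quadratic A B C p).fderiv, innerSL_apply_apply] at h2
  -- the difference of the two sides is tangent, so that it may be tested against itself
  set Z := W p • fderiv ℝ (euclideanNormal ρ') p X
    - inner ℝ ((2 * A) • p + B) (euclideanNormal ρ' p) • X with hZ
  have hZN : inner ℝ (euclideanNormal ρ' p) Z = 0 := by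
    rw [hZ, inner_sub_right, real_inner_smul_right, real_inner_smul_right, hX,
      inner_euclideanNormal_fderiv (hρ'.contDiffAt.of_le (by norm_cast)) hρ'.gradient_ne_zero]
    simp
  have hZZ : inner ℝ Z Z = (0 : ℝ) := by
    have h := key Z hZN
    conv_lhs => rw [hZ]
    rw [inner_sub_left, real_inner_smul_left, real_inner_smul_left]
    linarith
  exact sub_eq_zero.1 (inner_self_eq_zero.1 hZZ)

theorem exists_ne_zero_inner_eq_zero (hm : 1 ≤ m) (n : EuclideanSpace ℝ (Fin (m + 1))) :
    ∃ X, X ≠ 0 ∧ inner ℝ n X = 0 := by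
  have hlt : Module.finrank ℝ (Submodule.span ℝ {n}) <
      Module.finrank ℝ (EuclideanSpace ℝ (Fin (m + 1))) := by
    rw [finrank_euclideanSpace_fin]
    exact (finrank_span_le_card ({n} : Set _)).trans_lt (by simp; omega)
  have hne : (Submodule.span ℝ {n})ᗮ ≠ ⊥ := by
    intro h
    rw [Submodule.orthogonal_eq_bot_iff] at h
    rw [h, finrank_top] at hlt
    exact lt_irrefl _ hlt
  obtain ⟨X, hX, hX0⟩ := Submodule.exists_mem_ne_zero_of_ne_bot hne
  exact ⟨X, hX0, Submodule.mem_orthogonal_singleton_iff_inner_right.1 hX⟩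

/-- Near `p` the Euclidean unit normal of `∂Ω`, computed from any local defining function, is
`N = k x + c`. -/
def IsUmbilicAt (Ω : Set (EuclideanSpace ℝ (Fin (m + 1)))) (p : EuclideanSpace ℝ (Fin (m + 1)))
    (k : ℝ) (c : EuclideanSpace ℝ (Fin (m + 1))) : Prop :=
  ∀ᶠ x in 𝓝 p, x ∈ frontier Ω → ∀ ρ, IsLocalDefiningFunction Ω x ρ →
    euclideanNormal ρ x = k • x + c

/-- The constants in `N = k x + c` are determined by the germ of `∂Ω`: differentiate along a
curve. -/
theorem IsUmbilicAt.unique (hm : 1 ≤ m) {Ω : Set (EuclideanSpace ℝ (Fin (m + 1)))}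
    (hΩ : IsOpen Ω) {p : EuclideanSpace ℝ (Fin (m + 1))} (hp : p ∈ frontier Ω)
    {ρ : EuclideanSpace ℝ (Fin (m + 1)) → ℝ} (hρ : IsLocalDefiningFunction Ω p ρ) {k k' : ℝ}
    {c c' : EuclideanSpace ℝ (Fin (m + 1))} (h : IsUmbilicAt Ω p k c)
    (h' : IsUmbilicAt Ω p k' c') : k = k' ∧ c = c' := by
  obtain ⟨X, hX0, hX⟩ := exists_ne_zero_inner_eq_zero hm (_root_.gradient ρ p)
  obtain ⟨γ, hγ0, hγ, hγρ⟩ := exists_hasDerivAt_of_tangent (hρ.contDiffAt.of_le (by norm_cast))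
    hρ.gradient_ne_zero ((hρ.mem_frontier_iff hΩ).1 hp) hX
  have hc : Filter.Tendsto γ (𝓝 0) (𝓝 p) := by
    simpa [hγ0] using hγ.continuousAt.tendsto
  have hev : (fun t => k • γ t + c) =ᶠ[𝓝 0] fun t => k' • γ t + c' := by
    filter_upwards [hγρ, hc.eventually hρ.eventually, hc.eventually h, hc.eventually h']
      with t h1 h2 h3 h4
    have hf := (h2.mem_frontier_iff hΩ).2 h1
    rw [← h3 hf ρ h2, ← h4 hf ρ h2]
  have hkX : k • X = k' • X := ((hγ.const_smul k).add_const c).unique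
    (((hγ.const_smul k').add_const c').congr_of_eventuallyEq hev)
  have hk : k = k' := smul_left_injective ℝ hX0 hkX
  refine ⟨hk, ?_⟩
  have := hev.self_of_nhds
  rw [hk] at this
  exact add_left_cancel this

/-- The boundary of a simple non-generic domain is totally umbilic, with `N = k x + c` for
constants `k` and `c`. -/
theorem exists_umbilic_constants (hm : 1 ≤ m) {Ω : Set (EuclideanSpace ℝ (Fin (m + 1)))}
    (hΩ : IsSimpleNonGenericDomain (hyperbolicSpace m) (hyperbolicMetric m) Ω) :
    ∃ (k : ℝ) (c : EuclideanSpace ℝ (Fin (m + 1))), ∀ p ∈ boundaryIn (hyperbolicSpace m) Ω,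
      IsUmbilicAt Ω p k c := by
  obtain ⟨u, hu⟩ := hΩ.exists_potential
  have hD := hΩ.isSmoothDomain
  obtain ⟨A, B, C, hB, huW⟩ := exists_quadratic_of_isStaticPotential hm hD hu
  have hloc : ∀ p ∈ boundaryIn (hyperbolicSpace m) Ω, ∃ kc : ℝ × EuclideanSpace ℝ (Fin (m + 1)),
      IsUmbilicAt Ω p kc.1 kc.2 := by
    intro p hp
    obtain ⟨ρ, hρ⟩ := hD.smooth_boundary p hp
    have hU : {x | IsLocalDefiningFunction Ω x ρ} ∩ hyperbolicSpace m ∈ 𝓝 p :=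
      Filter.inter_mem hρ.eventually ((isOpen_hyperbolicSpace m).mem_nhds hp.2)
    have hR : IsRobinHypersurface ρ (fun x => A * ‖x‖ ^ 2 + inner ℝ B x + C)
        (fun x => (2 * A) • x + B) ({x | IsLocalDefiningFunction Ω x ρ} ∩ hyperbolicSpace m) :=
      ⟨fun x hx => hx.1.contDiffAt.of_le (by norm_cast), fun x hx => hx.1.gradient_ne_zero,
        fun x hx hx0 X hX => robin_of_isStaticPotential hD hu huW
          ⟨(hx.1.mem_frontier_iff hD.isOpen).2 hx0, hx.2⟩ hx.1 hX⟩
    have hnd : A * ‖p‖ ^ 2 + inner ℝ B p + C = 0 → (2 * A) • p + B ≠ 0 := by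
      intro hW hV
      -- a point of the half-space where `W` and its gradient vanish forces `W = 0`
      have hpn : p (Fin.last m) ≠ 0 := ne_of_gt hp.2
      have hA : A = 0 := by
        have := congrArg (fun v : EuclideanSpace ℝ (Fin (m + 1)) => v (Fin.last m)) hV
        simpa [hB, hpn] using this
      have hB0 : B = 0 := by simpa [hA] using hV
      have hC : C = 0 := by simpa [hA, hB0] using hW
      obtain ⟨x, hx, hux⟩ := hu.nontrivial
      rw [huW x ⟨subset_closure hx, hD.subset hx⟩, hA, hB0, hC] at hux
      simp at hux
    obtain ⟨k, c, hkc⟩ := hR.eventually_umbilic hU ((hρ.mem_frontier_iff hD.isOpen).1 hp.1)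
      ((contDiff_quadratic A B C).of_le (by norm_cast)) (hasFDerivAt_quadratic A B C)
      (hasFDerivAt_smul_add A B) hnd (exists_ne_zero_inner_eq_zero hm _)
    refine ⟨(k, c), ?_⟩
    filter_upwards [hkc, hρ.eventually] with x h1 h2 hx ρ' hρ'
    rw [← h1 ((h2.mem_frontier_iff hD.isOpen).1 hx), hρ'.euclideanNormal_eq hD.isOpen h2 hx]
  choose! f hf using hloc
  obtain ⟨p₀, hp₀⟩ := hΩ.isConnected_boundary.nonempty
  refine ⟨(f p₀).1, (f p₀).2, fun p hp => ?_⟩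
  rw [← eq_of_eventually_eq_of_isPreconnected hΩ.isConnected_boundary.isPreconnected
    (f := f) (fun p hp => ?_) hp hp₀]
  · exact hf p hp
  · refine (hf p hp).eventually_nhds.mono fun q hq hqb => ?_
    obtain ⟨ρ, hρ⟩ := hD.smooth_boundary q hqb
    have := IsUmbilicAt.unique hm hD.isOpen hqb.1 hρ (hf q hqb) hq
    exact Prod.ext this.1 this.2

/-- If `N = k x + c` on `∂Ω`, then `k |x|² + 2 ⟨c, x⟩` is constant on `∂Ω`, and `∂Ω` is open in the
level set of this function. -/
theorem exists_boundary_level (hm : 1 ≤ m) {Ω : Set (EuclideanSpace ℝ (Fin (m + 1)))}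
    (hΩ : IsSimpleNonGenericDomain (hyperbolicSpace m) (hyperbolicMetric m) Ω) :
    ∃ (k : ℝ) (c : EuclideanSpace ℝ (Fin (m + 1))) (b : ℝ),
      (∀ p ∈ boundaryIn (hyperbolicSpace m) Ω, ‖k • p + c‖ = 1) ∧
      (∀ p ∈ boundaryIn (hyperbolicSpace m) Ω, k * ‖p‖ ^ 2 + 2 * inner ℝ c p = b) ∧
      ∀ p ∈ boundaryIn (hyperbolicSpace m) Ω, ∀ᶠ x in 𝓝 p,
        k * ‖x‖ ^ 2 + 2 * inner ℝ c x = b → x ∈ frontier Ω := by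
  have hD := hΩ.isSmoothDomain
  obtain ⟨k, c, hkc⟩ := exists_umbilic_constants hm hΩ
  set G : EuclideanSpace ℝ (Fin (m + 1)) → ℝ :=
    fun x => k * ‖x‖ ^ 2 + inner ℝ ((2 : ℝ) • c) x + 0 with hG
  have hG' : ∀ x, k * ‖x‖ ^ 2 + 2 * inner ℝ c x = G x := fun x => by
    simp only [hG]
    rw [real_inner_smul_left, add_zero]
  have hGd : ∀ x v, fderiv ℝ G x v = 2 * inner ℝ (k • x + c) v := fun x v => by
    rw [(hasFDerivAt_quadratic k ((2 : ℝ) • c) 0 x).fderiv, innerSL_apply_apply, mul_smul,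
      ← smul_add, real_inner_smul_left]
  have hGc : ContDiff ℝ ∞ G := contDiff_quadratic k ((2 : ℝ) • c) 0
  have hN : ∀ p ∈ boundaryIn (hyperbolicSpace m) Ω, ∀ ρ, IsLocalDefiningFunction Ω p ρ →
      euclideanNormal ρ p = k • p + c := fun p hp ρ hρ => (hkc p hp).self_of_nhds hp.1 ρ hρ
  have hloc : ∀ p ∈ boundaryIn (hyperbolicSpace m) Ω, ∀ ρ, IsLocalDefiningFunction Ω p ρ →
      ∀ᶠ x in 𝓝 p, ρ x = 0 → G x = G p := by
    intro p hp ρ hρ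
    have hU : {x | IsLocalDefiningFunction Ω x ρ} ∩ hyperbolicSpace m ∈ 𝓝 p :=
      Filter.inter_mem hρ.eventually ((isOpen_hyperbolicSpace m).mem_nhds hp.2)
    refine eventually_eq_of_tangential_fderiv_eq_zero hU
      (fun x hx => ⟨hx.1.contDiffAt.of_le (by norm_cast), hx.1.gradient_ne_zero⟩)
      ((hρ.mem_frontier_iff hD.isOpen).1 hp.1) fun x hx hx0 =>
        ⟨hGc.contDiffAt.differentiableAt (by simp), fun v hv => ?_⟩
    rw [hN x ⟨(hx.1.mem_frontier_iff hD.isOpen).2 hx0, hx.2⟩ ρ hx.1] at hv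
    rw [hGd, hv, mul_zero]
  obtain ⟨p₀, hp₀⟩ := hΩ.isConnected_boundary.nonempty
  have hconst : ∀ p ∈ boundaryIn (hyperbolicSpace m) Ω, G p = G p₀ := fun p hp => by
    refine eq_of_eventually_eq_of_isPreconnected hΩ.isConnected_boundary.isPreconnected
      (fun p hp => ?_) hp hp₀
    obtain ⟨ρ, hρ⟩ := hD.smooth_boundary p hp
    filter_upwards [hloc p hp ρ hρ, hρ.eventually] with q h1 h2 hq
    exact h1 ((h2.mem_frontier_iff hD.isOpen).1 hq.1)
  refine ⟨k, c, G p₀, fun p hp => ?_, fun p hp => (hG' p).trans (hconst p hp), fun p hp => ?_⟩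
  · obtain ⟨ρ, hρ⟩ := hD.smooth_boundary p hp
    rw [← hN p hp ρ hρ, norm_euclideanNormal hρ.gradient_ne_zero]
  · obtain ⟨ρ, hρ⟩ := hD.smooth_boundary p hp
    have hn := norm_euclideanNormal hρ.gradient_ne_zero
    have h := eventually_level_subset_of_level_subset (n := euclideanNormal ρ p) (b := G p₀)
      (hρ.contDiffAt.of_le (by norm_cast)) (hGc.of_le (by norm_cast)).contDiffAt
      (by
        rw [fderiv_apply_eq_inner_euclideanNormal, real_inner_self_eq_norm_sq, hn]
        simpa using hρ.gradient_ne_zero)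
      (by
        rw [hGd, ← hN p hp ρ hρ, real_inner_self_eq_norm_sq, hn]
        norm_num)
      ((hρ.mem_frontier_iff hD.isOpen).1 hp.1) (by rw [← hconst p hp]; exact hloc p hp ρ hρ)
    filter_upwards [h, hρ.eventually] with x h1 h2 hx
    rw [hG'] at hx
    exact (h2.mem_frontier_iff hD.isOpen).2 (h1 hx)

/-- The boundary of a simple non-generic domain is a sphere or a hyperplane, intersected with the
half-space. -/
theorem boundary_eq_sphere_or_hyperplane (hm : 1 ≤ m) {Ω : Set (EuclideanSpace ℝ (Fin (m + 1)))}
    (hΩ : IsSimpleNonGenericDomain (hyperbolicSpace m) (hyperbolicMetric m) Ω) :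
    (∃ (c : EuclideanSpace ℝ (Fin (m + 1))) (r : ℝ), 0 < r ∧
      boundaryIn (hyperbolicSpace m) Ω = Metric.sphere c r ∩ hyperbolicSpace m) ∨
    ∃ (a : EuclideanSpace ℝ (Fin (m + 1))) (b : ℝ), a ≠ 0 ∧
      boundaryIn (hyperbolicSpace m) Ω = {y | inner ℝ a y = b} ∩ hyperbolicSpace m := by
  obtain ⟨k, c, b, h1, h2, h3⟩ := exists_boundary_level hm hΩ
  obtain ⟨p₀, hp₀⟩ := hΩ.isConnected_boundary.nonempty
  have key : ∀ Q : Set (EuclideanSpace ℝ (Fin (m + 1))),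
      Q = {x | k * ‖x‖ ^ 2 + 2 * inner ℝ c x = b} → IsPreconnected (Q ∩ hyperbolicSpace m) →
      boundaryIn (hyperbolicSpace m) Ω = Q ∩ hyperbolicSpace m := by
    rintro Q rfl hQ
    refine Set.Subset.antisymm (fun x hx => ⟨h2 x hx, hx.2⟩) fun x hx => ⟨?_, hx.2⟩
    refine IsPreconnected.subset_of_isClosed_of_relatively_open hQ isClosed_frontier
      ⟨p₀, ⟨h2 p₀ hp₀, hp₀.2⟩, hp₀.1⟩ (fun p hp => ?_) hx
    exact (h3 p ⟨hp.2, hp.1.2⟩).mono fun y hy hyQ => hy hyQ.1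
  by_cases hk : k = 0
  · right
    have hc : c ≠ 0 := by
      have := h1 p₀ hp₀
      rintro rfl
      simp [hk] at this
    refine ⟨c, b / 2, hc, key _ ?_ (convex_inner_eq c (b / 2)).isPreconnected⟩
    ext x
    simp only [hk, Set.mem_ofPred_eq]
    constructor <;> intro h <;> linarith
  · left
    have hr : 0 < |k|⁻¹ := inv_pos.2 (abs_pos.2 hk)
    refine ⟨-(k⁻¹ • c), |k|⁻¹, hr, key _ ?_
      (isPreconnected_sphere_inter_hyperbolicSpace hm _ hr)⟩
    have hsq : ∀ x, ‖k • x + c‖ ^ 2 = k * (k * ‖x‖ ^ 2 + 2 * inner ℝ c x) + ‖c‖ ^ 2 := fun x => by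
      rw [norm_add_sq_real, norm_smul, mul_pow, Real.norm_eq_abs, sq_abs, real_inner_smul_left,
        real_inner_comm]
      ring
    have hp := hsq p₀
    rw [h1 p₀ hp₀, h2 p₀ hp₀] at hp
    ext x
    have e : x - -(k⁻¹ • c) = k⁻¹ • (k • x + c) := by
      rw [smul_add, smul_smul, inv_mul_cancel₀ hk, one_smul, sub_neg_eq_add]
    rw [mem_sphere_iff_norm, e, norm_smul, norm_inv, Real.norm_eq_abs, Set.mem_ofPred_eq,
      mul_eq_left₀ hr.ne', ← sq_eq_sq₀ (norm_nonneg _) zero_le_one, hsq]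
    constructor
    · intro h
      exact mul_left_cancel₀ hk (by linarith)
    · intro h
      rw [h]
      linarith

end HalfSpace

end

theorem mainTheorem3 (m : ℕ) (hm : 1 ≤ m) (S : Set (EuclideanSpace ℝ (Fin (m + 1)))) :
    (∃ Ω : Set (EuclideanSpace ℝ (Fin (m + 1))),
      Coord.IsSimpleNonGenericDomain (HalfSpace.hyperbolicSpace m) (HalfSpace.hyperbolicMetric m) Ω ∧
        Coord.boundaryIn (HalfSpace.hyperbolicSpace m) Ω = S) ↔
    (HalfSpace.IsHorosphere m S ∨ HalfSpace.IsHypersphere m S ∨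
      HalfSpace.IsGeodesicSphere m S ∨ HalfSpace.IsHyperplaneSection m S) := by
  constructor
  · rintro ⟨Ω, hΩ, rfl⟩
    have hne := hΩ.isConnected_boundary.nonempty
    rcases HalfSpace.boundary_eq_sphere_or_hyperplane hm hΩ with ⟨c, r, hr, h⟩ | ⟨a, b, ha, h⟩
    · rw [h] at hne ⊢
      rcases HalfSpace.sphere_inter_hyperbolicSpace_classification hr hne with h | h | h
      · exact Or.inl h
      · exact Or.inr (Or.inl h)
      · exact Or.inr (Or.inr (Or.inl h))
    · exact Or.inr (Or.inr (Or.inr ⟨a, b, ha, h, hne⟩))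
  · rintro (⟨c, r, hr, hc, rfl⟩ | ⟨c, r, hr, hc, rfl⟩ | ⟨c, r, hr, hc, rfl⟩ | ⟨a, b, ha, rfl, hne⟩)
    · exact HalfSpace.exists_domain_of_sphere hm hr (by linarith)
    · exact HalfSpace.exists_domain_of_sphere hm hr (abs_lt.1 hc).1
    · have hcr : -r < c (Fin.last m) := by
        -- the top point `c + r eₙ` of the sphere is in the half-space
        have := @hc (c + r • EuclideanSpace.single (Fin.last m) 1) (by
          rw [mem_sphere_iff_norm, add_sub_cancel_left, norm_smul, Real.norm_eq_abs,
            abs_of_pos hr]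
          simp)
        have h : 0 < (c + r • EuclideanSpace.single (Fin.last m) (1 : ℝ)) (Fin.last m) := this
        simp at h
        linarith
      have := HalfSpace.exists_domain_of_sphere hm hr hcr
      rwa [Set.inter_eq_left.2 hc] at this
    · exact HalfSpace.exists_domain_of_hyperplane hm ha hne
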